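/- Let $\mathbb F_q$ be a finite field with $q$ elements, $n\ge 0$, and let $(\mathcal A,\partial)$ be a semi-free DGA over $\mathbb F_q$ of the type of the fully non-commutative Chekanov–Eliashberg DGA of a Legendrian knot $\Lambda\subset\mathbb R^3$ with rotation number $0$ and one base point. That is, $\mathcal A$ is the unital associative $\mathbb F_q$-algebra freely generated by $a_1,\dots,a_m$ (the Reeb chords, with integer degrees $|a_i|$, labelled by increasing height) and an invertible generator $t$ of degree $0$ which does not commute with the $a_i$; $\partial$ is an $\mathbb F_q$-linear differential of degree $-1$ ($\partial^2=0$) that satisfies the signed Leibniz rule $\partial(zw)=(\partial z)w+(-1)^{|z|}z\,\partial w$, vanishes on $\mathbb F_q[t^{\pm1}]$, and maps each $a_i$ into the subalgebra generated by $t^{\pm1},a_1,\dots,a_{i-1}$. An $n$-dimensional representation is a unital DGA map $\rho:(\mathcal A,\partial)\to(\mathrm{Mat}_n(\mathbb F_q),0)$, with $\mathrm{Mat}_n(\mathbb F_q)$ in degree $0$; so $\rho\circ\partial=0$ and $\rho(a_i)=0$ unless $|a_i|=0$. These are the objects of the (positive) representation category $\mathcal{R}ep_n$. The space $\mathrm{Hom}(\rho_1,\rho_2)$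 is the free $\mathrm{Mat}_n(\mathbb F_q)$-module on $a_1^\vee,\dots,a_m^\vee,x^\vee,y^\vee$, graded by $|a_i^\vee|=|a_i|+1$, $|x^\vee|=1$, $|y^\vee|=0$. The compositions come from the $N$-copy of $(\mathcal A,\partial)$. Its generators are $a_\ell^{ij}$ ($1\le i,j\le N$), $x^{ij},y^{ij}$ ($1\le i<j\le N$) and invertible $t_i$ ($1\le i\le N$). Let $A_\ell=(a_\ell^{ij})$, let $X$ be the upper unitriangular matrix with entries $x^{ij}$ above the diagonal, $Y$ the strictly upper triangular matrix with entries $y^{ij}$, $\Delta=\mathrm{diag}(t_1,\dots,t_N)$, and let $\Phi$ be the algebra map with $\Phi(a_\ell)=A_\ell$, $\Phi(t)=\Delta X$. Then, entry by entry, $$\partial A_\ell=\Phi(\partial a_\ell)+YA_\ell-(-1)^{|a_\ell|}A_\ell Y,\qquad \partial X=\Delta^{-1}Y\Delta X-XY,\qquad \partial Y=Y^2 .$$ For representations $\rho_1,\dots,\rho_{k+1}$, take $N=k+1$ and twist this differential by the substitution $a_\ell^{ij}\mapsto a_\ell^{ij}+\delta_{ij}\rho_i(a_\ell)$, $t_i\mapsto\rho_i(t)$,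 $x^{ij}\mapsto x^{ij}$, $y^{ij}\mapsto y^{ij}$, which takes values in the algebra generated freely over $\mathbb F_q$ by the algebra $\mathrm{Mat}_n(\mathbb F_q)$ and the letters $a_\ell^{ij},x^{ij},y^{ij}$. Each term $A_k\,c_k^{1,2}A_{k-1}c_{k-1}^{2,3}\cdots c_1^{k,k+1}A_0$ (with $A_j\in\mathrm{Mat}_n(\mathbb F_q)$) of the twisted differential of $b^{1,k+1}$ contributes the term $(-1)^\sigma A_kM_kA_{k-1}M_{k-1}\cdots M_1A_0\,b^\vee$ to $m_k(M_1c_1^\vee,\dots,M_kc_k^\vee)$, where $\sigma=\frac{k(k-1)}2+\sum_{p<r}|c_p^\vee||c_r^\vee|+|c_2^\vee|+|c_4^\vee|+\cdots$. This defines the $\mathbb F_q$-multilinear maps $$m_k:\mathrm{Hom}(\rho_k,\rho_{k+1})\otimes\cdots\otimes\mathrm{Hom}(\rho_1,\rho_2)\to\mathrm{Hom}(\rho_1,\rho_{k+1}).$$ Let $H^0\mathrm{Hom}(\rho_1,\rho_2)$ be the quotient of the $m_1$-cocycles of degree $0$ by $B^0(\rho_1,\rho_2)=m_1(\mathrm{Hom}^{-1}(\rho_1,\rho_2))$.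 In the cohomology category, composition is induced by $m_2$ and the unit is $[-y^\vee]$. Write $\rho\cong\rho_0$ if there are degree-$0$ cocycles $\alpha\in\mathrm{Hom}^0(\rho,\rho_0)$ and $\beta\in\mathrm{Hom}^0(\rho_0,\rho)$ with $[m_2(\beta,\alpha)]=[-y^\vee]$ in $H^0\mathrm{Hom}(\rho,\rho)$ and $[m_2(\alpha,\beta)]=[-y^\vee]$ in $H^0\mathrm{Hom}(\rho_0,\rho_0)$, and let $\mathrm{Aut}(\rho)$ be the set of invertible elements of $H^0\mathrm{Hom}(\rho,\rho)$. Then, for every $n$-dimensional representation $\rho$ of $(\mathcal A,\partial)$, $$\bigl|\{\rho_0:\mathcal A\to\mathrm{Mat}_n(\mathbb F_q)\ :\ \rho\cong\rho_0\}\bigr|=\frac{|\mathrm{GL}_n(\mathbb F_q)|}{|\mathrm{Aut}(\rho)|}\;q^{\,\dim_{\mathbb F_q}\mathrm{Hom}^0(\rho,\rho)-\dim_{\mathbb F_q}B^0(\rho,\rho)-n^2}.$$ -/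

import Mathlib

noncomputable section

namespace RepCat

/-! ## Free algebras with some invertible generators -/

/-- The unital associative `F`-algebra freely generated by the letters `s : S` and by invertible
letters `t : T`; the invertible letters do not commute with the other ones. -/
abbrev FreeLaurent (F : Type*) [Field F] (S T : Type*) : Type _ :=
  MonoidAlgebra F (Monoid.Coprod (FreeMonoid S) (FreeGroup T))

namespace FreeLaurent

variable {F : Type*} [Field F] {S T : Type*}

/-- The generator `s`. -/
def gen (s : S) : FreeLaurent F S T :=
  MonoidAlgebra.of F _ (Monoid.Coprod.inl (FreeMonoid.of s))

/-- The invertible generator `t`. -/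
def inv (t : T) : (FreeLaurent F S T)ˣ :=
  Units.map ((MonoidAlgebra.of F (Monoid.Coprod (FreeMonoid S) (FreeGroup T))).comp
    Monoid.Coprod.inr) (toUnits (FreeGroup.of t))

/-- The algebra map with prescribed values on the generators. -/
def lift {B : Type*} [Ring B] [Algebra F B] (f : S → B) (u : T → Bˣ) :
    FreeLaurent F S T →ₐ[F] B :=
  MonoidAlgebra.lift F B (Monoid.Coprod (FreeMonoid S) (FreeGroup T))
    (Monoid.Coprod.lift (FreeMonoid.lift f) ((Units.coeHom B).comp (FreeGroup.lift u)))

@[simp]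
theorem lift_gen {B : Type*} [Ring B] [Algebra F B] (f : S → B) (u : T → Bˣ) (s : S) :
    lift (F := F) f u (gen s) = f s := by
  simp [lift, gen]

@[simp]
theorem lift_inv {B : Type*} [Ring B] [Algebra F B] (f : S → B) (u : T → Bˣ) (t : T) :
    lift (F := F) f u ((inv t : (FreeLaurent F S T)ˣ) : FreeLaurent F S T) = u t := by
  simp [lift, inv]

/-- The degree of a word, where `s` has degree `deg s` and invertible letters have degree `0`. -/
def wordDeg (deg : S → ℤ) : Monoid.Coprod (FreeMonoid S) (FreeGroup T) →* Multiplicative ℤ :=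
  Monoid.Coprod.lift (FreeMonoid.lift fun s => Multiplicative.ofAdd (deg s)) 1

/-- The homogeneous elements of degree `p`. -/
def homogeneous (deg : S → ℤ) (p : ℤ) : Submodule F (FreeLaurent F S T) :=
  Submodule.span F
    {z | ∃ w, wordDeg deg w = Multiplicative.ofAdd p ∧ z = MonoidAlgebra.of F _ w}

/-- The algebra maps out of `FreeLaurent` take values in a subalgebra as soon as the generators and
the inverses of the invertible generators are sent there. -/
theorem lift_mem {B : Type*} [Ring B] [Algebra F B] (f : S → B) (u : T → Bˣ)
    (P : Subalgebra F B) (hf : ∀ s, f s ∈ P) (hu : ∀ t, (u t : B) ∈ P)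
    (hu' : ∀ t, ((u t)⁻¹ : Bˣ).val ∈ P) (z : FreeLaurent F S T) : lift (F := F) f u z ∈ P := by
  have key : ∀ w : Monoid.Coprod (FreeMonoid S) (FreeGroup T),
      Monoid.Coprod.lift (FreeMonoid.lift f) ((Units.coeHom B).comp (FreeGroup.lift u)) w ∈ P := by
    intro w
    induction w using Monoid.Coprod.induction_on with
    | inl a =>
      rw [Monoid.Coprod.lift_apply_inl]
      induction a using FreeMonoid.inductionOn with
      | one => simp
      | of s => simpa using hf s
      | mul a b ha hb => rw [map_mul]; exact P.mul_mem ha hb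
    | inr g =>
      rw [Monoid.Coprod.lift_apply_inr]
      induction g using FreeGroup.induction_on with
      | C1 => simp
      | of t => simpa using hu t
      | inv_of t _ => simpa using hu' t
      | mul a b ha hb => rw [map_mul]; exact P.mul_mem ha hb
    | mul a b ha hb => rw [map_mul]; exact P.mul_mem ha hb
  induction z using MonoidAlgebra.induction_on with
  | of w => simpa [lift] using key w
  | add a b ha hb => rw [map_add]; exact P.add_mem ha hb
  | smul r a ha => rw [map_smul]; exact P.smul_mem ha r

end FreeLaurent

/-! ## The DGA of a knot with one base point, and its representations -/

/-- A semi-free differential graded algebra over `F` with finitely many generators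
`a_0, …, a_{m-1}` (for a Legendrian knot of rotation number zero with one base point: the Reeb
chords, labelled by increasing height) and one invertible generator `t` of degree `0` (the base
point), which does not commute with the `a_i`. -/
structure ChordDGA (F : Type*) [Field F] (m : ℕ) where
  /-- the grading of the generators -/
  deg : Fin m → ℤ
  /-- the differential -/
  d : FreeLaurent F (Fin m) Unit →ₗ[F] FreeLaurent F (Fin m) Unit
  /-- the differential has degree `-1` -/
  d_degree : ∀ (p : ℤ), ∀ z ∈ FreeLaurent.homogeneous deg p,
    d z ∈ FreeLaurent.homogeneous deg (p - 1)
  /-- the signed Leibniz rule -/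
  d_mul : ∀ (p : ℤ), ∀ z ∈ FreeLaurent.homogeneous deg p, ∀ w : FreeLaurent F (Fin m) Unit,
    d (z * w) = d z * w + (-1 : F) ^ p • (z * d w)
  /-- the differential vanishes on `F[t, t⁻¹]` -/
  d_inv : ∀ e : ℤ, d ((FreeLaurent.inv () ^ e : (FreeLaurent F (Fin m) Unit)ˣ) :
    FreeLaurent F (Fin m) Unit) = 0
  d_d : ∀ z, d (d z) = 0
  /-- the differential lowers the height -/
  d_height : ∀ i : Fin m, d (FreeLaurent.gen i) ∈ Algebra.adjoin F
    (({((FreeLaurent.inv () : (FreeLaurent F (Fin m) Unit)ˣ) : FreeLaurent F (Fin m) Unit),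
      ((FreeLaurent.inv () : (FreeLaurent F (Fin m) Unit)ˣ)⁻¹).val} :
        Set (FreeLaurent F (Fin m) Unit)) ∪ FreeLaurent.gen '' {j : Fin m | j < i})

variable {F : Type*} [Field F] {m : ℕ}

/-- An `n`-dimensional representation: a unital DGA map to `(Mat_n(F), 0)`, where `Mat_n(F)` is
concentrated in degree `0`. -/
structure Representation (D : ChordDGA F m) (n : ℕ) where
  toAlgHom : FreeLaurent F (Fin m) Unit →ₐ[F] Matrix (Fin n) (Fin n) F
  map_d : ∀ z, toAlgHom (D.d z) = 0
  map_gen : ∀ i, D.deg i ≠ 0 → toAlgHom (FreeLaurent.gen i) = 0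

/-! ## The `N`-copy -/

/-- The generators `a_ℓ^{ij}` (all `i, j`), and `x^{ij}`, `y^{ij}` (for `i < j`) of the `N`-copy. -/
inductive CopyGen (m N : ℕ) : Type
  | a (l : Fin m) (i j : Fin N) : CopyGen m N
  | x (i j : Fin N) (h : i < j) : CopyGen m N
  | y (i j : Fin N) (h : i < j) : CopyGen m N

/-- The algebra of the `N`-copy; the invertible generators are `t_1, …, t_N`. -/
abbrev CopyAlg (F : Type*) [Field F] (m N : ℕ) : Type _ :=
  FreeLaurent F (CopyGen m N) (Fin N)

/-- The matrix `A_ℓ`. -/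
def matA (F : Type*) [Field F] {m : ℕ} (N : ℕ) (l : Fin m) :
    Matrix (Fin N) (Fin N) (CopyAlg F m N) :=
  Matrix.of fun i j => FreeLaurent.gen (CopyGen.a l i j)

/-- The matrix `X`: upper triangular with diagonal entries `1`. -/
def matX (F : Type*) [Field F] (m N : ℕ) : Matrix (Fin N) (Fin N) (CopyAlg F m N) :=
  Matrix.of fun i j =>
    if h : i < j then FreeLaurent.gen (CopyGen.x i j h) else if i = j then 1 else 0

/-- The strictly upper triangular matrix `Y`. -/
def matY (F : Type*) [Field F] (m N : ℕ) : Matrix (Fin N) (Fin N) (CopyAlg F m N) :=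
  Matrix.of fun i j => if h : i < j then FreeLaurent.gen (CopyGen.y i j h) else 0

/-- The diagonal matrix `Δ` with entries `t_1, …, t_N`, as an invertible matrix. -/
def matDelta (F : Type*) [Field F] (m N : ℕ) : (Matrix (Fin N) (Fin N) (CopyAlg F m N))ˣ where
  val := Matrix.diagonal fun i => (FreeLaurent.inv i : (CopyAlg F m N)ˣ).val
  inv := Matrix.diagonal fun i => ((FreeLaurent.inv i : (CopyAlg F m N)ˣ)⁻¹).val
  val_inv := by simp [Matrix.diagonal_mul_diagonal]
  inv_val := by simp [Matrix.diagonal_mul_diagonal]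

theorem one_sub_matX_pow (F : Type*) [Field F] (m N s : ℕ) (i j : Fin N)
    (h : (j : ℕ) < i + s) : ((1 - matX F m N) ^ s) i j = 0 := by
  induction s generalizing j with
  | zero =>
    have : i ≠ j := by rintro rfl; simp at h
    simp [Matrix.one_apply_ne this]
  | succ s ih =>
    rw [pow_succ, Matrix.mul_apply]
    refine Finset.sum_eq_zero fun k _ => ?_
    by_cases hk : (k : ℕ) < i + s
    · rw [ih k hk, zero_mul]
    · have hjk : ¬ k < j := by rw [Fin.lt_def]; omega
      by_cases e : k = j
      · subst e; simp [matX]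
      · simp [matX, hjk, e, Matrix.one_apply_ne e]

theorem one_sub_matX_pow_eq_zero (F : Type*) [Field F] (m N : ℕ) : (1 - matX F m N) ^ N = 0 := by
  ext1 i j
  exact one_sub_matX_pow F m N N i j (by have := j.2; omega)

/-- The unipotent matrix `X` as an invertible matrix. -/
def unitX (F : Type*) [Field F] (m N : ℕ) : (Matrix (Fin N) (Fin N) (CopyAlg F m N))ˣ where
  val := matX F m N
  inv := ∑ s ∈ Finset.range N, (1 - matX F m N) ^ s
  val_inv := by
    have h := mul_neg_geom_sum (1 - matX F m N) N
    rwa [one_sub_matX_pow_eq_zero, sub_zero, sub_sub_cancel] at h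
  inv_val := by
    have h := geom_sum_mul_neg (1 - matX F m N) N
    rwa [one_sub_matX_pow_eq_zero, sub_zero, sub_sub_cancel] at h

/-- The algebra map `Φ` with `Φ(a_ℓ) = A_ℓ`, `Φ(t) = Δ X` and `Φ(t⁻¹) = X⁻¹ Δ⁻¹`. -/
def copyPhi (F : Type*) [Field F] (m N : ℕ) :
    FreeLaurent F (Fin m) Unit →ₐ[F] Matrix (Fin N) (Fin N) (CopyAlg F m N) :=
  FreeLaurent.lift (fun l => matA F N l) (fun _ => matDelta F m N * unitX F m N)

/-- The generators `a_1^∨, …, a_m^∨, x^∨, y^∨` of the morphism spaces. -/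
inductive DualGen (m : ℕ) : Type
  | a (l : Fin m) : DualGen m
  | x : DualGen m
  | y : DualGen m
  deriving DecidableEq, Fintype

/-- The degrees `|a_ℓ^∨| = |a_ℓ| + 1`, `|x^∨| = 1`, `|y^∨| = 0`. -/
def ChordDGA.dualDeg (D : ChordDGA F m) : DualGen m → ℤ
  | .a l => D.deg l + 1
  | .x => 1
  | .y => 0

/-- The differential of the `N`-copy on generators, entry by entry:
`∂A_ℓ = Φ(∂a_ℓ) + Y A_ℓ - (-1)^{|a_ℓ|} A_ℓ Y`, `∂X = Δ⁻¹ Y Δ X - X Y` and `∂Y = Y²`. -/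
def ChordDGA.copyD (D : ChordDGA F m) (N : ℕ) :
    DualGen m → Matrix (Fin N) (Fin N) (CopyAlg F m N)
  | .a l => copyPhi F m N (D.d (FreeLaurent.gen l)) + matY F m N * matA F N l
      - (-1 : F) ^ D.deg l • (matA F N l * matY F m N)
  | .x => ((matDelta F m N)⁻¹).val * matY F m N * (matDelta F m N).val * matX F m N
      - matX F m N * matY F m N
  | .y => matY F m N * matY F m N

/-! ## Twisting by a pure representation -/

/-- The relations that make the letters from `B` in a free algebra into a copy of the algebra
`B`. -/
inductive TensorAlgRel (F : Type*) [Field F] (B : Type*) [Ring B] [Algebra F B] (S : Type*) :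
    FreeAlgebra F (B ⊕ S) → FreeAlgebra F (B ⊕ S) → Prop
  | add (b c : B) : TensorAlgRel F B S (FreeAlgebra.ι F (Sum.inl (b + c)))
      (FreeAlgebra.ι F (Sum.inl b) + FreeAlgebra.ι F (Sum.inl c))
  | mul (b c : B) : TensorAlgRel F B S (FreeAlgebra.ι F (Sum.inl (b * c)))
      (FreeAlgebra.ι F (Sum.inl b) * FreeAlgebra.ι F (Sum.inl c))
  | scalar (r : F) : TensorAlgRel F B S (FreeAlgebra.ι F (Sum.inl (algebraMap F B r)))
      (algebraMap F _ r)

/-- The tensor algebra over `B` of the free `B`-`B`-bimodule (over `F`) on the set `S`, that is the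
algebra generated by `B` and the letters in `S`, which satisfy no relation with `B`. -/
abbrev TensorAlg (F : Type*) [Field F] (B : Type*) [Ring B] [Algebra F B] (S : Type*) : Type _ :=
  RingQuot (TensorAlgRel F B S)

namespace TensorAlg

variable {B : Type*} [Ring B] [Algebra F B] {S : Type*}

/-- The inclusion of the coefficient algebra. -/
def coeff : B →ₐ[F] TensorAlg F B S :=
  AlgHom.ofLinearMap
    { toFun := fun b => RingQuot.mkAlgHom F (TensorAlgRel F B S) (FreeAlgebra.ι F (Sum.inl b))
      map_add' := fun b c => by
        rw [RingQuot.mkAlgHom_rel F (TensorAlgRel.add b c), map_add]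
      map_smul' := fun r b => by
        rw [Algebra.smul_def, RingQuot.mkAlgHom_rel F (TensorAlgRel.mul _ b), map_mul,
          RingQuot.mkAlgHom_rel F (TensorAlgRel.scalar r), AlgHom.commutes, ← Algebra.smul_def]
        rfl }
    (by
      have h := RingQuot.mkAlgHom_rel F (TensorAlgRel.scalar (F := F) (B := B) (S := S) 1)
      simpa using h)
    (fun b c => by
      have h := RingQuot.mkAlgHom_rel F (TensorAlgRel.mul (F := F) (S := S) b c)
      simpa using h)

/-- The generator `s`. -/
def gen (s : S) : TensorAlg F B S :=
  RingQuot.mkAlgHom F (TensorAlgRel F B S) (FreeAlgebra.ι F (Sum.inr s))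

/-- The algebra map to `B` that is the identity on `B` and replaces the letter `s` by `f s`. -/
def eval (f : S → B) : TensorAlg F B S →ₐ[F] B :=
  RingQuot.liftAlgHom F ⟨FreeAlgebra.lift F (Sum.elim id f), by
    intro u v h
    cases h <;> simp⟩

@[simp]
theorem eval_coeff (f : S → B) (b : B) : eval (F := F) f (coeff b) = b := by
  change eval (F := F) f (RingQuot.mkAlgHom F _ _) = b
  simp [eval]

@[simp]
theorem eval_gen (f : S → B) (s : S) : eval (F := F) f (gen s) = f s := by
  simp [eval, gen]

end TensorAlg

variable {D : ChordDGA F m} {n : ℕ}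

/-- The twisting map of the `N`-copy for the pure representation `(ρ_1, …, ρ_N)`:
`a_ℓ^{ij} ↦ a_ℓ^{ij} + δ_{ij} ρ_i(a_ℓ)`, `x^{ij} ↦ x^{ij}`, `y^{ij} ↦ y^{ij}`, `t_i ↦ ρ_i(t)`. -/
def twist {N : ℕ} (ρ : Fin N → Representation D n) :
    CopyAlg F m N →ₐ[F] TensorAlg F (Matrix (Fin n) (Fin n) F) (CopyGen m N) :=
  FreeLaurent.lift
    (fun g => match g with
      | .a l i j => TensorAlg.gen (.a l i j) +
          if i = j then TensorAlg.coeff ((ρ i).toAlgHom (FreeLaurent.gen l)) else 0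
      | .x i j h => TensorAlg.gen (.x i j h)
      | .y i j h => TensorAlg.gen (.y i j h))
    (fun i => Units.map (TensorAlg.coeff.comp (ρ i).toAlgHom).toMonoidHom (FreeLaurent.inv ()))

/-! ## Morphisms and compositions -/

/-- The morphism space `Hom(ρ_1, ρ_2)`: the free `Mat_n(F)`-module on `a_1^∨, …, a_m^∨, x^∨, y^∨`.
The element `α` stands for the sum of all `α(c) c^∨`. -/
abbrev HomSpace (F : Type*) [Field F] (m n : ℕ) : Type _ :=
  DualGen m → Matrix (Fin n) (Fin n) F

/-- The generator `c^{ij}` of the `N`-copy belongs to the generator `c^∨`. -/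
def CopyGen.kind {N : ℕ} : CopyGen m N → DualGen m
  | .a l _ _ => .a l
  | .x _ _ _ => .x
  | .y _ _ _ => .y

/-- The upper index `i` of `c^{ij}`. -/
def CopyGen.row {N : ℕ} : CopyGen m N → Fin N
  | .a _ i _ => i
  | .x i _ _ => i
  | .y i _ _ => i

/-- The upper index `j` of `c^{ij}`. -/
def CopyGen.col {N : ℕ} : CopyGen m N → Fin N
  | .a _ _ j => j
  | .x _ j _ => j
  | .y _ j _ => j

/-- The value `M_s` on the letter `c_s^{s,s+1}`, and `0` on all other letters. -/
def letterValue {k : ℕ} (c : Fin k → DualGen m) (M : Fin k → Matrix (Fin n) (Fin n) F)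
    (g : CopyGen m (k + 1)) : Matrix (Fin n) (Fin n) F :=
  ∑ s : Fin k, if g.row = s.castSucc ∧ g.col = s.succ ∧ g.kind = c s then M s else 0

/-- The sum of the terms `A_0 c_0^{01} A_1 c_1^{12} ⋯ c_{k-1}^{k-1,k} A_k` in the augmented
differential of `b^{0k}` in the `(k+1)`-copy, with each letter `c_s^{s,s+1}` replaced by `M_s`. All
other words in this entry contain some letter that is replaced by `0`, because consecutive upper
indices in a word match. -/
def dualTerm {k : ℕ} (ρ : Fin (k + 1) → Representation D n) (c : Fin k → DualGen m)
    (M : Fin k → Matrix (Fin n) (Fin n) F) (b : DualGen m) : Matrix (Fin n) (Fin n) F :=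
  TensorAlg.eval (letterValue c M) (twist ρ (D.copyD (k + 1) b 0 (Fin.last k)))

/-- The sign exponent `k(k-1)/2 + ∑_{p<q} |c_p||c_q| + |c_2| + |c_4| + ⋯` where `c_p`, for
`p = 1, …, k`, is the `p`-th argument of `m_k`. The first argument lies in `Hom(ρ_k, ρ_{k+1})` and
the last one in `Hom(ρ_1, ρ_2)`, so the `p`-th argument has index `k - p` here. -/
def ChordDGA.signExp (D : ChordDGA F m) {k : ℕ} (c : Fin k → DualGen m) : ℤ :=
  (k : ℤ) * (k - 1) / 2
    + (∑ s : Fin k, ∑ r : Fin k, if s < r then D.dualDeg (c s) * D.dualDeg (c r) else 0)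
    + ∑ s : Fin k, if Even (k - (s : ℕ)) then D.dualDeg (c s) else 0

/-- The composition `m_k(α_{k-1}, …, α_0)` for `α_s ∈ Hom(ρ_s, ρ_{s+1})`. -/
def mOp {k : ℕ} (ρ : Fin (k + 1) → Representation D n) (α : Fin k → HomSpace F m n) :
    HomSpace F m n :=
  fun b => ∑ c : Fin k → DualGen m, (-1 : F) ^ D.signExp c • dualTerm ρ c (fun s => α s (c s)) b

/-! ### Linearity of `m_1` -/

/-- Matrices over the `2`-copy that become upper triangular with diagonal independent of `M` and
with upper right entry linear in `M`, when the letter `c^{01}` is replaced by `M`. -/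
def linearEntries (ρ : Fin 2 → Representation D n) (c : Fin 1 → DualGen m) :
    Subalgebra F (Matrix (Fin 2) (Fin 2) (CopyAlg F m 2)) where
  carrier := {P | ∃ (u v : Matrix (Fin n) (Fin n) F)
    (l : Matrix (Fin n) (Fin n) F →ₗ[F] Matrix (Fin n) (Fin n) F),
    ∀ M : Matrix (Fin n) (Fin n) F,
      TensorAlg.eval (letterValue c fun _ => M) (twist ρ (P 0 0)) = u ∧
      TensorAlg.eval (letterValue c fun _ => M) (twist ρ (P 0 1)) = l M ∧
      TensorAlg.eval (letterValue c fun _ => M) (twist ρ (P 1 0)) = 0 ∧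
      TensorAlg.eval (letterValue c fun _ => M) (twist ρ (P 1 1)) = v}
  mul_mem' := by
    rintro P Q ⟨u, v, l, h⟩ ⟨u', v', l', h'⟩
    refine ⟨u * u', v * v', LinearMap.mulLeft F u ∘ₗ l' + LinearMap.mulRight F v' ∘ₗ l,
      fun M => ?_⟩
    obtain ⟨h1, h2, h3, h4⟩ := h M
    obtain ⟨h1', h2', h3', h4'⟩ := h' M
    simp [Matrix.mul_apply, Fin.sum_univ_two, h1, h2, h3, h4, h1', h2', h3', h4']
  add_mem' := by
    rintro P Q ⟨u, v, l, h⟩ ⟨u', v', l', h'⟩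
    refine ⟨u + u', v + v', l + l', fun M => ?_⟩
    obtain ⟨h1, h2, h3, h4⟩ := h M
    obtain ⟨h1', h2', h3', h4'⟩ := h' M
    simp [h1, h2, h3, h4, h1', h2', h3', h4']
  algebraMap_mem' r := by
    refine ⟨algebraMap F _ r, algebraMap F _ r, 0, fun M => ?_⟩
    simp only [Matrix.algebraMap_matrix_apply]
    refine ⟨?_, ?_, ?_, ?_⟩
    · rw [if_pos trivial, AlgHom.commutes, AlgHom.commutes]
    · simp
    · simp
    · rw [if_pos trivial, AlgHom.commutes, AlgHom.commutes]

theorem matA_mem (ρ : Fin 2 → Representation D n) (c : Fin 1 → DualGen m) (l : Fin m) :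
    matA F 2 l ∈ linearEntries ρ c := by
  refine ⟨(ρ 0).toAlgHom (FreeLaurent.gen l), (ρ 1).toAlgHom (FreeLaurent.gen l),
    if DualGen.a l = c 0 then LinearMap.id else 0, fun M => ?_⟩
  simp [matA, twist, letterValue, CopyGen.row, CopyGen.col, CopyGen.kind]
  split_ifs <;> simp

theorem matX_mem (ρ : Fin 2 → Representation D n) (c : Fin 1 → DualGen m) :
    matX F m 2 ∈ linearEntries ρ c := by
  refine ⟨1, 1, if DualGen.x = c 0 then LinearMap.id else 0, fun M => ?_⟩
  simp [matX, twist, letterValue, CopyGen.row, CopyGen.col, CopyGen.kind]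
  split_ifs <;> simp

theorem matY_mem (ρ : Fin 2 → Representation D n) (c : Fin 1 → DualGen m) :
    matY F m 2 ∈ linearEntries ρ c := by
  refine ⟨0, 0, if DualGen.y = c 0 then LinearMap.id else 0, fun M => ?_⟩
  simp [matY, twist, letterValue, CopyGen.row, CopyGen.col, CopyGen.kind]
  split_ifs <;> simp

theorem lift_inv_inv {S T B : Type*} [Ring B] [Algebra F B] (f : S → B) (u : T → Bˣ) (t : T) :
    FreeLaurent.lift (F := F) f u (((FreeLaurent.inv t : (FreeLaurent F S T)ˣ)⁻¹).val)
      = ((u t)⁻¹).val := by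
  simp [FreeLaurent.lift, FreeLaurent.inv]

theorem matDelta_mem (ρ : Fin 2 → Representation D n) (c : Fin 1 → DualGen m) :
    (matDelta F m 2).val ∈ linearEntries ρ c := by
  refine ⟨(ρ 0).toAlgHom (FreeLaurent.inv ()).val, (ρ 1).toAlgHom (FreeLaurent.inv ()).val, 0,
    fun M => ?_⟩
  simp [matDelta, twist]

theorem matDelta_inv_mem (ρ : Fin 2 → Representation D n) (c : Fin 1 → DualGen m) :
    ((matDelta F m 2)⁻¹).val ∈ linearEntries ρ c := by
  refine ⟨(ρ 0).toAlgHom ((FreeLaurent.inv ())⁻¹).val, (ρ 1).toAlgHom ((FreeLaurent.inv ())⁻¹).val,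
    0, fun M => ?_⟩
  change TensorAlg.eval _ (twist ρ (Matrix.diagonal _ 0 0)) = _ ∧
    TensorAlg.eval _ (twist ρ (Matrix.diagonal _ 0 1)) = _ ∧
    TensorAlg.eval _ (twist ρ (Matrix.diagonal _ 1 0)) = _ ∧
    TensorAlg.eval _ (twist ρ (Matrix.diagonal _ 1 1)) = _
  simp [twist, lift_inv_inv]

theorem unitX_inv_mem (ρ : Fin 2 → Representation D n) (c : Fin 1 → DualGen m) :
    ((unitX F m 2)⁻¹).val ∈ linearEntries ρ c := by
  change ∑ s ∈ Finset.range 2, (1 - matX F m 2) ^ s ∈ linearEntries ρ c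
  exact Subalgebra.sum_mem _ fun s _ =>
    Subalgebra.pow_mem _ (Subalgebra.sub_mem _ (Subalgebra.one_mem _) (matX_mem ρ c)) s

theorem copyPhi_mem (ρ : Fin 2 → Representation D n) (c : Fin 1 → DualGen m)
    (z : FreeLaurent F (Fin m) Unit) : copyPhi F m 2 z ∈ linearEntries ρ c := by
  unfold copyPhi
  refine FreeLaurent.lift_mem (fun l => matA F 2 l) (fun _ => matDelta F m 2 * unitX F m 2)
    (linearEntries ρ c) (fun l => matA_mem ρ c l) (fun _ => ?_) (fun _ => ?_) z
  · rw [Units.val_mul]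
    exact Subalgebra.mul_mem _ (matDelta_mem ρ c) (matX_mem ρ c)
  · rw [mul_inv_rev, Units.val_mul]
    exact Subalgebra.mul_mem _ (unitX_inv_mem ρ c) (matDelta_inv_mem ρ c)

theorem copyD_mem (ρ : Fin 2 → Representation D n) (c : Fin 1 → DualGen m) (b : DualGen m) :
    D.copyD 2 b ∈ linearEntries ρ c := by
  have hX := matX_mem ρ c
  have hY := matY_mem ρ c
  cases b with
  | a l =>
    have hA := matA_mem ρ c l
    exact Subalgebra.sub_mem _ (Subalgebra.add_mem _ (copyPhi_mem ρ c _)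
      (Subalgebra.mul_mem _ hY hA)) (Subalgebra.smul_mem _ (Subalgebra.mul_mem _ hA hY) _)
  | x =>
    have hD := matDelta_mem ρ c
    have hD' := matDelta_inv_mem ρ c
    exact Subalgebra.sub_mem _ (Subalgebra.mul_mem _ (Subalgebra.mul_mem _
      (Subalgebra.mul_mem _ hD' hY) hD) hX) (Subalgebra.mul_mem _ hX hY)
  | y => exact Subalgebra.mul_mem _ hY hY

theorem dualTerm_linear (ρ : Fin 2 → Representation D n) (c : Fin 1 → DualGen m) (b : DualGen m) :
    ∃ l : Matrix (Fin n) (Fin n) F →ₗ[F] Matrix (Fin n) (Fin n) F,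
      ∀ M, dualTerm ρ c (fun _ => M) b = l M := by
  obtain ⟨_, _, l, h⟩ := copyD_mem ρ c b
  exact ⟨l, fun M => (h M).2.1⟩

/-- The differential `m_1` of `Hom(ρ₁, ρ₂)`. -/
def m1 (ρ₁ ρ₂ : Representation D n) : HomSpace F m n →ₗ[F] HomSpace F m n where
  toFun α := mOp ![ρ₁, ρ₂] ![α]
  map_add' α β := by
    ext1 b
    simp only [mOp, Pi.add_apply]
    rw [← Finset.sum_add_distrib]
    refine Finset.sum_congr rfl fun c _ => ?_
    obtain ⟨l, hl⟩ := dualTerm_linear ![ρ₁, ρ₂] c b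
    have e : ∀ γ : HomSpace F m n,
        (fun s : Fin 1 => (![γ] : Fin 1 → HomSpace F m n) s (c s)) = fun _ => γ (c 0) := by
      intro γ; funext s; fin_cases s; rfl
    rw [e, e, e, hl, hl, hl, Pi.add_apply, map_add, smul_add]
  map_smul' r α := by
    ext1 b
    simp only [mOp, Pi.smul_apply, RingHom.id_apply]
    rw [Finset.smul_sum]
    refine Finset.sum_congr rfl fun c _ => ?_
    obtain ⟨l, hl⟩ := dualTerm_linear ![ρ₁, ρ₂] c b
    have e : ∀ γ : HomSpace F m n,
        (fun s : Fin 1 => (![γ] : Fin 1 → HomSpace F m n) s (c s)) = fun _ => γ (c 0) := by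
      intro γ; funext s; fin_cases s; rfl
    rw [e, e, hl, hl, Pi.smul_apply, map_smul, smul_comm]

/-- The composition `m_2(α, β) ∈ Hom(ρ₁, ρ₃)` of `α ∈ Hom(ρ₂, ρ₃)` and `β ∈ Hom(ρ₁, ρ₂)`. -/
def m2 (ρ₁ ρ₂ ρ₃ : Representation D n) (α β : HomSpace F m n) : HomSpace F m n :=
  mOp ![ρ₁, ρ₂, ρ₃] ![β, α]

/-! ## The cohomology category in degree zero -/

/-- The elements of degree `p` of a morphism space. -/
def homDeg (D : ChordDGA F m) (n : ℕ) (p : ℤ) : Submodule F (HomSpace F m n) where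
  carrier := {α | ∀ c, D.dualDeg c ≠ p → α c = 0}
  add_mem' hα hβ c hc := by simp [hα c hc, hβ c hc]
  zero_mem' := by simp
  smul_mem' r α hα c hc := by simp [hα c hc]

/-- The cocycles of degree `0` in `Hom(ρ₁, ρ₂)`. -/
def cocycles (ρ₁ ρ₂ : Representation D n) : Submodule F (HomSpace F m n) :=
  homDeg D n 0 ⊓ LinearMap.ker (m1 ρ₁ ρ₂)

/-- The coboundaries `B^0(ρ₁, ρ₂)` of degree `0`. -/
def coboundaries (ρ₁ ρ₂ : Representation D n) : Submodule F (HomSpace F m n) :=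
  (homDeg D n (-1)).map (m1 ρ₁ ρ₂)

/-- The cohomology `H^0 Hom(ρ₁, ρ₂)`. -/
abbrev H0 (ρ₁ ρ₂ : Representation D n) : Type _ :=
  cocycles ρ₁ ρ₂ ⧸ (coboundaries ρ₁ ρ₂).submoduleOf (cocycles ρ₁ ρ₂)

/-- The strict unit `-y^∨`. -/
def unitHom (F : Type*) [Field F] (m n : ℕ) : HomSpace F m n :=
  Pi.single DualGen.y (-1)

/-- The cocycles `α ∈ Hom⁰(ρ₁, ρ₂)` and `β ∈ Hom⁰(ρ₂, ρ₁)` have mutually inverse classes in the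
cohomology category. -/
def MutuallyInverse (ρ₁ ρ₂ : Representation D n) (α : cocycles ρ₁ ρ₂) (β : cocycles ρ₂ ρ₁) :
    Prop :=
  m2 ρ₁ ρ₂ ρ₁ β.1 α.1 - unitHom F m n ∈ coboundaries ρ₁ ρ₁ ∧
    m2 ρ₂ ρ₁ ρ₂ α.1 β.1 - unitHom F m n ∈ coboundaries ρ₂ ρ₂

/-- Two representations are isomorphic if they are isomorphic in the cohomology category. -/
def Isomorphic (ρ₁ ρ₂ : Representation D n) : Prop :=
  ∃ (α : cocycles ρ₁ ρ₂) (β : cocycles ρ₂ ρ₁), MutuallyInverse ρ₁ ρ₂ α β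

/-- The set `Aut(ρ)` of invertible elements of `H^0 Hom(ρ, ρ)`. -/
def Aut (ρ : Representation D n) : Set (H0 ρ ρ) :=
  {u | ∃ α β : cocycles ρ ρ, Submodule.Quotient.mk α = u ∧ MutuallyInverse ρ ρ α β}

end RepCat

end

noncomputable section

namespace RepCat

/-! ### Free algebras with invertible letters: reduction to generators -/

namespace FreeLaurent

variable {F : Type*} [Field F] {S T : Type*}

/-! The count comes from one observation: fix $\rho$ and a degree-$0$ morphism $\alpha$ whose
coefficient at $y^\vee$ is an invertible matrix $g$. The cocycle equation then determines the
target. It reads $g\,\rho_0(t)=\rho(t)\,g$ and, for each chord,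
$g\,\rho_0(a_l)=\rho(a_l)\,g-(\text{terms in }\partial a_l)$. The last terms involve only $\rho_0$
on lower chords, so the equations can be solved by recursion on height. The resulting algebra map
kills all $\partial a_l$, because applying the homotopy relation to $\partial a_l$ gives
$g\,\rho_0(\partial a_l)=0$. Hence the degree-$0$ morphisms with invertible $y^\vee$ coefficient are
the disjoint union over all $\rho_0$ of the cocycles $\rho\to\rho_0$ with invertible $y^\vee$
coefficient (`bijective_target`).

Such cocycles are exactly the isomorphisms. Composition with one of them is injective, since it is
triangular in height with invertible diagonal (`m2_left_injective`, `m2_right_injective`). As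
everything is finite, pigeonhole gives a strict left inverse and a strict right inverse
(`exists_left_inverse`, `exists_right_inverse`). Composition is associative only up to homotopy, so
these two need not coincide, but an explicit $m_3$-type homotopy shows that they are cohomologous
(`sub_mem_coboundaries`). Together with the compatibility of $m_2$ with coboundaries
(`m2_sub_m2_mem`), this gives mutually inverse classes.

It remains to count. Every nonempty piece of the disjoint union has as many elements as the piece
$\rho\to\rho$, by composition. That piece maps onto $\mathrm{Aut}(\rho)$ with fibres the cosets of
$B^0(\rho,\rho)$. The whole union has $|\mathrm{GL}_n|\,q^{\dim\mathrm{Hom}^0-n^2}$ elements.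

The $A_\infty$ identities that are needed are not derived from the $N$-copy. Instead $m_1$ and $m_2$
are expressed by entries of block triangular algebra maps (`chain`). The first superdiagonal entries
are derivations along pairs of representations. The further entries satisfy product rules with
cup-product corrections. Each identity says that a combination of such entries is a derivation, and
a derivation is determined by its values on $t$ and the chords. -/

theorem inv_inv_eq (t : T) : (((inv t : (FreeLaurent F S T)ˣ)⁻¹).val) =
    MonoidAlgebra.of F (Monoid.Coprod (FreeMonoid S) (FreeGroup T))
      (Monoid.Coprod.inr (FreeGroup.of t)⁻¹) := by
  rw [← Units.mul_eq_one_iff_inv_eq]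
  simp only [inv, Units.coe_map, MonoidHom.comp_apply, val_toUnits_apply]
  rw [← map_mul, ← map_mul, mul_inv_cancel, map_one, map_one]

/-- The elements on which a subalgebra condition holds for all generators are everything. -/
theorem mem_of_generators (P : Subalgebra F (FreeLaurent F S T)) (hs : ∀ s, gen s ∈ P)
    (ht : ∀ t, ((inv t : (FreeLaurent F S T)ˣ) : FreeLaurent F S T) ∈ P)
    (ht' : ∀ t, ((inv t : (FreeLaurent F S T)ˣ)⁻¹).val ∈ P) (z : FreeLaurent F S T) : z ∈ P := by
  have key : ∀ w, MonoidAlgebra.of F (Monoid.Coprod (FreeMonoid S) (FreeGroup T)) w ∈ P := by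
    intro w
    induction w using Monoid.Coprod.induction_on with
    | inl a =>
      induction a using FreeMonoid.inductionOn with
      | one => rw [map_one, map_one]; exact P.one_mem
      | of s => exact hs s
      | mul a b ha hb => rw [map_mul, map_mul]; exact P.mul_mem ha hb
    | inr g =>
      induction g using FreeGroup.induction_on with
      | C1 => rw [map_one, map_one]; exact P.one_mem
      | of t => exact ht t
      | inv_of t _ => rw [← inv_inv_eq]; exact ht' t
      | mul a b ha hb => rw [map_mul, map_mul]; exact P.mul_mem ha hb
    | mul a b ha hb => rw [map_mul]; exact P.mul_mem ha hb
  induction z using MonoidAlgebra.induction_on with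
  | of w => exact key w
  | add a b ha hb => exact P.add_mem ha hb
  | smul r a ha => exact P.smul_mem ha r

theorem gen_mem_homogeneous (deg : S → ℤ) (s : S) :
    (gen s : FreeLaurent F S T) ∈ homogeneous deg (deg s) :=
  Submodule.subset_span ⟨_, by simp [wordDeg], rfl⟩

theorem map_eq_zero_iff {R : Type*} [Ring R] [Algebra F R] (φ : FreeLaurent F S T →ₐ[F] R) (t : T)
    (r : R) : φ ((inv t : (FreeLaurent F S T)ˣ).val) * r = 0 ↔ r = 0 := by
  refine ⟨fun h => ?_, fun h => by rw [h, mul_zero]⟩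
  have := congrArg (φ (((inv t : (FreeLaurent F S T)ˣ)⁻¹).val) * ·) h
  simpa [← mul_assoc, ← map_mul] using this

end FreeLaurent

/-! ### Height, and algebra maps and derivations determined on generators -/

open FreeLaurent

variable {F : Type*} [Field F] {m : ℕ}

/-- The invertible generator `t`. -/
abbrev tGen (F : Type*) [Field F] (m : ℕ) : (FreeLaurent F (Fin m) Unit)ˣ := FreeLaurent.inv ()

/-- The subalgebra generated by `t`, `t⁻¹` and the generators of height below `i`. -/
abbrev below (F : Type*) [Field F] {m : ℕ} (i : Fin m) : Subalgebra F (FreeLaurent F (Fin m) Unit) :=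
  Algebra.adjoin F
    (({((FreeLaurent.inv () : (FreeLaurent F (Fin m) Unit)ˣ) : FreeLaurent F (Fin m) Unit),
      ((FreeLaurent.inv () : (FreeLaurent F (Fin m) Unit)ˣ)⁻¹).val} :
        Set (FreeLaurent F (Fin m) Unit)) ∪ FreeLaurent.gen '' {j : Fin m | j < i})

theorem below_le {i : Fin m} {P : Subalgebra F (FreeLaurent F (Fin m) Unit)}
    (ht : (tGen F m).val ∈ P) (ht' : ((tGen F m)⁻¹).val ∈ P) (hg : ∀ j < i, gen j ∈ P) :
    below F i ≤ P := by
  refine Algebra.adjoin_le ?_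
  rintro z ((rfl | rfl) | ⟨j, hj, rfl⟩)
  exacts [ht, ht', hg j hj]

section Algebras

variable {R : Type*} [Ring R] [Algebra F R]

/-- With $\partial a_i$ lying below $a_i$, this is the source of every recursion on height. -/
theorem eqOn_below {i : Fin m} (V V' : Fin m → R) (u : Unit → Rˣ) (h : ∀ j < i, V j = V' j)
    {z : FreeLaurent F (Fin m) Unit} (hz : z ∈ below F i) :
    lift (F := F) V u z = lift (F := F) V' u z := by
  have : below F i ≤ AlgHom.equalizer (lift (F := F) V u) (lift (F := F) V' u) := by
    refine below_le ?_ ?_ ?_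
    · simp [AlgHom.mem_equalizer]
    · simp only [AlgHom.mem_equalizer, lift_inv_inv]
    · intro j hj
      simp [AlgHom.mem_equalizer, h j hj]
  exact this hz

theorem map_tGen_inv (φ : FreeLaurent F (Fin m) Unit →ₐ[F] R) :
    φ ((tGen F m)⁻¹).val = ((Units.map φ.toMonoidHom (tGen F m))⁻¹).val := rfl

theorem algHom_ext {φ ψ : FreeLaurent F (Fin m) Unit →ₐ[F] R} (h : ∀ l, φ (gen l) = ψ (gen l))
    (ht : φ (tGen F m).val = ψ (tGen F m).val) : φ = ψ := by
  have ht' : φ ((tGen F m)⁻¹).val = ψ ((tGen F m)⁻¹).val := by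
    rw [map_tGen_inv, map_tGen_inv]
    congr 2
    exact Units.ext ht
  exact AlgHom.ext fun w => mem_of_generators (AlgHom.equalizer φ ψ) h (fun _ => ht) (fun _ => ht') w

/-! ### Derivations along pairs of algebra maps -/

/-- A derivation along the pair `(φ, ψ)` of algebra maps. -/
def IsDer (φ ψ : FreeLaurent F (Fin m) Unit →ₐ[F] R) (δ : FreeLaurent F (Fin m) Unit →ₗ[F] R) :
    Prop :=
  ∀ z w, δ (z * w) = δ z * ψ w + φ z * δ w

namespace IsDer

variable {φ ψ : FreeLaurent F (Fin m) Unit →ₐ[F] R} {δ δ' : FreeLaurent F (Fin m) Unit →ₗ[F] R}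

theorem map_one (h : IsDer φ ψ δ) : δ 1 = 0 := by
  have := h 1 1
  simpa using this

/-- The kernel of a derivation. -/
def ker (h : IsDer φ ψ δ) : Subalgebra F (FreeLaurent F (Fin m) Unit) where
  carrier := {z | δ z = 0}
  mul_mem' := fun {z w} hz hw => by
    have hz' : δ z = 0 := hz
    have hw' : δ w = 0 := hw
    simp [h z w, hz', hw']
  add_mem' := fun {z w} hz hw => by
    have hz' : δ z = 0 := hz
    have hw' : δ w = 0 := hw
    simp [hz', hw']
  algebraMap_mem' r := by
    simp [Algebra.algebraMap_eq_smul_one, h.map_one]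

theorem map_tGen_inv (h : IsDer φ ψ δ) (ht : δ (tGen F m).val = 0) :
    δ ((tGen F m)⁻¹).val = 0 := by
  have := h (tGen F m).val ((tGen F m)⁻¹).val
  rw [Units.mul_inv, h.map_one, ht, zero_mul, zero_add] at this
  exact (map_eq_zero_iff φ () _).1 this.symm

/-- The kernel of a derivation along algebra maps is a subalgebra, and it contains $t^{-1}$ with $t$
because $0=\delta(tt^{-1})=\varphi(t)\,\delta(t^{-1})$. Almost all identities below are checked on
generators in this way. -/
theorem eq_zero (h : IsDer φ ψ δ) (ht : δ (tGen F m).val = 0) (hg : ∀ j, δ (gen j) = 0)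
    (z : FreeLaurent F (Fin m) Unit) : δ z = 0 :=
  mem_of_generators h.ker hg (fun _ => ht) (fun _ => h.map_tGen_inv ht) z

theorem sub (h : IsDer φ ψ δ) (h' : IsDer φ ψ δ') : IsDer φ ψ (δ - δ') := by
  intro z w
  simp only [LinearMap.sub_apply, h z w, h' z w]
  noncomm_ring

theorem add (h : IsDer φ ψ δ) (h' : IsDer φ ψ δ') : IsDer φ ψ (δ + δ') := by
  intro z w
  simp only [LinearMap.add_apply, h z w, h' z w]
  noncomm_ring

theorem ext (h : IsDer φ ψ δ) (h' : IsDer φ ψ δ') (ht : δ (tGen F m).val = δ' (tGen F m).val)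
    (hg : ∀ j, δ (gen j) = δ' (gen j)) (z : FreeLaurent F (Fin m) Unit) : δ z = δ' z :=
  sub_eq_zero.1 ((h.sub h').eq_zero (sub_eq_zero.2 ht) (fun j => sub_eq_zero.2 (hg j)) z)

end IsDer

end Algebras

/-! ### The parity automorphism -/

namespace ChordDGA

variable (D : ChordDGA F m)

/-- The algebra map that multiplies elements of degree `p` by `(-1)^p`. -/
def parity : FreeLaurent F (Fin m) Unit →ₐ[F] FreeLaurent F (Fin m) Unit :=
  lift (fun l => (-1 : F) ^ D.deg l • gen l) (fun _ => tGen F m)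

@[simp]
theorem parity_gen (l : Fin m) : D.parity (gen l) = (-1 : F) ^ D.deg l • gen l := by
  simp [parity]

@[simp]
theorem parity_tGen : D.parity (tGen F m).val = (tGen F m).val := by
  simp [parity]

theorem parity_of (w : Monoid.Coprod (FreeMonoid (Fin m)) (FreeGroup Unit)) :
    D.parity (MonoidAlgebra.of F _ w) =
      (-1 : F) ^ (Multiplicative.toAdd (wordDeg D.deg w)) • MonoidAlgebra.of F _ w := by
  induction w using Monoid.Coprod.induction_on with
  | inl a =>
    induction a using FreeMonoid.inductionOn with
    | one => simp only [map_one, toAdd_one, zpow_zero, one_smul]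
    | of s =>
      have := D.parity_gen s
      rw [FreeLaurent.gen] at this
      rw [this]
      simp [wordDeg]
    | mul a b ha hb =>
      simp only [map_mul, toAdd_mul] at *
      rw [ha, hb, zpow_add₀ (by simp), smul_mul_smul_comm]
  | inr g =>
    induction g using FreeGroup.induction_on with
    | C1 => simp only [map_one, toAdd_one, zpow_zero, one_smul]
    | of t =>
      have := D.parity_tGen
      simp only [wordDeg, Monoid.Coprod.lift_apply_inr, MonoidHom.one_apply, toAdd_one, zpow_zero,
        one_smul]
      exact this
    | inv_of t _ =>
      simp only [wordDeg, Monoid.Coprod.lift_apply_inr, MonoidHom.one_apply, toAdd_one, zpow_zero,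
        one_smul]
      rw [← inv_inv_eq]
      simp only [parity, lift_inv_inv]
    | mul a b ha hb =>
      simp only [map_mul, toAdd_mul] at *
      rw [ha, hb, zpow_add₀ (by simp), smul_mul_smul_comm]
  | mul a b ha hb =>
    simp only [map_mul, toAdd_mul] at *
    rw [ha, hb, zpow_add₀ (by simp), smul_mul_smul_comm]

theorem of_mem_homogeneous (w : Monoid.Coprod (FreeMonoid (Fin m)) (FreeGroup Unit)) :
    MonoidAlgebra.of F _ w ∈ homogeneous D.deg (Multiplicative.toAdd (wordDeg D.deg w)) :=
  Submodule.subset_span ⟨w, by simp, rfl⟩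

/-- Writing the sign as the parity automorphism removes the homogeneity assumption from the Leibniz
rule. Representations do not see parity, so the signs mostly disappear after applying them. -/
theorem d_mul_parity (z w : FreeLaurent F (Fin m) Unit) :
    D.d (z * w) = D.d z * w + D.parity z * D.d w := by
  induction z using MonoidAlgebra.induction_on with
  | of g =>
    rw [D.parity_of, D.d_mul _ _ (D.of_mem_homogeneous g), smul_mul_assoc]
  | add a b ha hb => simp only [add_mul, map_add, ha, hb]; abel
  | smul r a ha => simp only [smul_mul_assoc, map_smul, ha, smul_add]

theorem d_tGen : D.d (tGen F m).val = 0 := by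
  simpa using D.d_inv 1

theorem d_gen_mem (l : Fin m) : D.d (gen l) ∈ homogeneous D.deg (D.deg l - 1) :=
  D.d_degree _ _ (gen_mem_homogeneous _ _)

/-! ### The twisted derivation of an algebra map -/

variable {R : Type*} [Ring R] [Algebra F R]

/-- The failure of `Ψ` to intertwine `∂` with the inner derivation by `Y`. -/
def theta (Ψ : FreeLaurent F (Fin m) Unit →ₐ[F] R) (Y : R) : FreeLaurent F (Fin m) Unit →ₗ[F] R :=
  Ψ.toLinearMap ∘ₗ D.d + LinearMap.mulLeft F Y ∘ₗ Ψ.toLinearMap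
    - LinearMap.mulRight F Y ∘ₗ (Ψ.comp D.parity).toLinearMap

theorem theta_apply (Ψ : FreeLaurent F (Fin m) Unit →ₐ[F] R) (Y : R)
    (z : FreeLaurent F (Fin m) Unit) :
    D.theta Ψ Y z = Ψ (D.d z) + Y * Ψ z - Ψ (D.parity z) * Y := rfl

end ChordDGA

section Chains

variable {R : Type*} [Ring R] [Algebra F R]

/-! ### Block triangular algebra maps -/

/-- The invertible diagonal matrix with given invertible entries. -/
def diagUnit {N : ℕ} (u : Fin N → Rˣ) : (Matrix (Fin N) (Fin N) R)ˣ where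
  val := Matrix.diagonal fun i => (u i).val
  inv := Matrix.diagonal fun i => ((u i)⁻¹).val
  val_inv := by simp [Matrix.diagonal_mul_diagonal]
  inv_val := by simp [Matrix.diagonal_mul_diagonal]

/-- The matrix with entries `y_s` directly above the diagonal. -/
def superMat {k : ℕ} (y : Fin k → R) : Matrix (Fin (k + 1)) (Fin (k + 1)) R :=
  Matrix.of fun i j => ∑ s : Fin k, if i = s.castSucc ∧ j = s.succ then y s else 0

/-- The matrix with diagonal entries `ρ_i(a_l)` and with entries `f_s(l)` directly above the
diagonal. -/
def chainGen {k : ℕ} (ρ : Fin (k + 1) → FreeLaurent F (Fin m) Unit →ₐ[F] R)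
    (f : Fin k → Fin m → R) (l : Fin m) : Matrix (Fin (k + 1)) (Fin (k + 1)) R :=
  Matrix.diagonal (fun i => ρ i (gen l)) + superMat fun s => f s l

/-- The algebra map to block triangular matrices with diagonal `ρ_i` and with `f_s` directly above
the diagonal on the generators `a_l`. -/
def chain {k : ℕ} (ρ : Fin (k + 1) → FreeLaurent F (Fin m) Unit →ₐ[F] R)
    (f : Fin k → Fin m → R) :
    FreeLaurent F (Fin m) Unit →ₐ[F] Matrix (Fin (k + 1)) (Fin (k + 1)) R :=
  lift (chainGen ρ f) fun _ => diagUnit fun i => Units.map (ρ i).toMonoidHom (tGen F m)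

theorem superMat_castSucc_succ {k : ℕ} (y : Fin k → R) (s : Fin k) :
    superMat y s.castSucc s.succ = y s := by
  simp only [superMat, Matrix.of_apply]
  rw [Finset.sum_eq_single s]
  · simp
  · intro b _ hb
    rw [if_neg]
    rintro ⟨h, _⟩
    exact hb (Fin.castSucc_injective _ h).symm
  · simp

theorem superMat_of_ne {k : ℕ} (y : Fin k → R) (i j : Fin (k + 1)) (h : (j : ℕ) ≠ i + 1) :
    superMat y i j = 0 := by
  simp only [superMat, Matrix.of_apply]
  refine Finset.sum_eq_zero fun s _ => if_neg ?_
  rintro ⟨rfl, rfl⟩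
  simp at h

theorem superMat_mul_superMat_of_ne {k : ℕ} (y y' : Fin k → R) (i j : Fin (k + 1))
    (h : (j : ℕ) ≠ i + 2) : (superMat y * superMat y') i j = 0 := by
  rw [Matrix.mul_apply]
  refine Finset.sum_eq_zero fun s _ => ?_
  by_cases hs : (s : ℕ) = i + 1
  · rw [superMat_of_ne y' s j (by omega), mul_zero]
  · rw [superMat_of_ne y i s hs, zero_mul]

variable {k : ℕ} (ρ : Fin (k + 1) → FreeLaurent F (Fin m) Unit →ₐ[F] R) (f : Fin k → Fin m → R)

@[simp]
theorem chain_gen (l : Fin m) : chain ρ f (gen l) = chainGen ρ f l := by simp [chain]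

@[simp]
theorem chain_tGen :
    chain ρ f (tGen F m).val = Matrix.diagonal fun i => ρ i (tGen F m).val := by
  simp [chain, diagUnit]

theorem chain_tGen_inv :
    chain ρ f ((tGen F m)⁻¹).val = Matrix.diagonal fun i => ρ i ((tGen F m)⁻¹).val := by
  simp only [chain, lift_inv_inv]
  rfl

theorem chainGen_castSucc_succ (l : Fin m) (s : Fin k) :
    chainGen ρ f l s.castSucc s.succ = f s l := by
  rw [chainGen, Matrix.add_apply, superMat_castSucc_succ,
    Matrix.diagonal_apply_ne _ (Fin.castSucc_lt_succ).ne, zero_add]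

theorem chainGen_self (l : Fin m) (i : Fin (k + 1)) : chainGen ρ f l i i = ρ i (gen l) := by
  rw [chainGen, Matrix.add_apply, superMat_of_ne _ _ _ (by omega), Matrix.diagonal_apply_eq,
    add_zero]

theorem chainGen_of_ne (l : Fin m) (i j : Fin (k + 1)) (h : i ≠ j) (h' : (j : ℕ) ≠ i + 1) :
    chainGen ρ f l i j = 0 := by
  rw [chainGen, Matrix.add_apply, superMat_of_ne _ _ _ h', Matrix.diagonal_apply_ne _ h, add_zero]

/-- Upper triangular matrices are closed under products, and their diagonal entries multiply. A
subalgebra need not contain inverses, so $t^{-1}$ is checked separately; its image is also diagonal.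
-/
theorem chain_triangular (z : FreeLaurent F (Fin m) Unit) :
    ∀ i j, (j < i → chain ρ f z i j = 0) ∧ (i = j → chain ρ f z i j = ρ i z) := by
  let P : Subalgebra F (FreeLaurent F (Fin m) Unit) :=
    { carrier := {z | ∀ i j, (j < i → chain ρ f z i j = 0) ∧ (i = j → chain ρ f z i j = ρ i z)}
      mul_mem' := by
        intro z w hz hw i j
        simp only [map_mul, Matrix.mul_apply]
        refine ⟨fun h => Finset.sum_eq_zero fun s _ => ?_, ?_⟩
        · by_cases hs : s < i
          · rw [(hz i s).1 hs, zero_mul]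
          · rw [(hw s j).1 (h.trans_le (not_lt.1 hs)), mul_zero]
        · rintro rfl
          rw [Finset.sum_eq_single i]
          · rw [(hz i i).2 rfl, (hw i i).2 rfl]
          · intro s _ hs
            rcases lt_or_gt_of_ne hs with h | h
            · rw [(hz i s).1 h, zero_mul]
            · rw [(hw s i).1 h, mul_zero]
          · simp
      add_mem' := by
        intro z w hz hw i j
        simp only [map_add, Matrix.add_apply]
        exact ⟨fun h => by rw [(hz i j).1 h, (hw i j).1 h, add_zero],
          fun h => by rw [(hz i j).2 h, (hw i j).2 h]⟩
      algebraMap_mem' := by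
        intro r i j
        simp only [AlgHom.commutes, Matrix.algebraMap_matrix_apply]
        exact ⟨fun h => if_neg h.ne', fun h => if_pos h⟩ }
  refine mem_of_generators P (fun l i j => ?_) (fun _ i j => ?_) (fun _ i j => ?_) z
  · rw [chain_gen]
    refine ⟨fun h => chainGen_of_ne _ _ _ _ _ h.ne' ?_, ?_⟩
    · rw [Fin.lt_def] at h; omega
    · rintro rfl; exact chainGen_self _ _ _ _
  · rw [chain_tGen]
    refine ⟨fun h => Matrix.diagonal_apply_ne _ h.ne', ?_⟩
    rintro rfl; exact Matrix.diagonal_apply_eq _ _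
  · rw [chain_tGen_inv]
    refine ⟨fun h => Matrix.diagonal_apply_ne _ h.ne', ?_⟩
    rintro rfl; exact Matrix.diagonal_apply_eq _ _

theorem chain_lower (z : FreeLaurent F (Fin m) Unit) {i j : Fin (k + 1)} (h : j < i) :
    chain ρ f z i j = 0 := (chain_triangular ρ f z i j).1 h

@[simp]
theorem chain_self (z : FreeLaurent F (Fin m) Unit) (i : Fin (k + 1)) :
    chain ρ f z i i = ρ i z := (chain_triangular ρ f z i i).2 rfl

theorem chain_eqOn_below (ρ' : Fin (k + 1) → FreeLaurent F (Fin m) Unit →ₐ[F] R)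
    (f' : Fin k → Fin m → R) {i : Fin m} (ht : ∀ r, ρ r (tGen F m).val = ρ' r (tGen F m).val)
    (hg : ∀ r, ∀ j < i, ρ r (gen j) = ρ' r (gen j)) (h : ∀ s, ∀ j < i, f s j = f' s j)
    {z : FreeLaurent F (Fin m) Unit} (hz : z ∈ below F i) : chain ρ f z = chain ρ' f' z := by
  have hu (r : Fin (k + 1)) : Units.map (ρ r).toMonoidHom (tGen F m) =
      Units.map (ρ' r).toMonoidHom (tGen F m) := Units.ext (ht r)
  simp only [chain, hu]
  refine eqOn_below _ _ _ (fun j hj => ?_) hz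
  simp only [chainGen, hg _ j hj, h _ j hj]

/-- The entry `(i, j)` of a matrix valued linear map. -/
def entry {N : ℕ} (Ψ : FreeLaurent F (Fin m) Unit →ₗ[F] Matrix (Fin N) (Fin N) R) (i j : Fin N) :
    FreeLaurent F (Fin m) Unit →ₗ[F] R :=
  Matrix.entryLinearMap F R i j ∘ₗ Ψ

@[simp]
theorem entry_apply {N : ℕ} (Ψ : FreeLaurent F (Fin m) Unit →ₗ[F] Matrix (Fin N) (Fin N) R)
    (i j : Fin N) (z) : entry Ψ i j z = Ψ z i j := rfl

theorem sum_triangular_succ (P Q : Matrix (Fin (k + 1)) (Fin (k + 1)) R)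
    (hP : ∀ i j, j < i → P i j = 0) (hQ : ∀ i j, j < i → Q i j = 0) (s : Fin k) :
    (P * Q) s.castSucc s.succ = P s.castSucc s.succ * Q s.succ s.succ
      + P s.castSucc s.castSucc * Q s.castSucc s.succ := by
  rw [Matrix.mul_apply, Finset.sum_eq_add s.succ s.castSucc (Fin.castSucc_lt_succ).ne']
  · intro c _ hc
    rcases lt_or_ge c s.castSucc with h | h
    · rw [hP _ _ h, zero_mul]
    · rw [hQ, mul_zero]
      have h1 := lt_of_le_of_ne h hc.2.symm
      rw [Fin.lt_def] at h1 ⊢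
      have h2 := fun h => hc.1 (Fin.ext h)
      simp at h1 h2 ⊢
      omega
  · simp
  · simp

/-- In a product of upper triangular matrices, only the two adjacent diagonal entries meet the first
superdiagonal. -/
theorem chain_isDer (s : Fin k) :
    IsDer (ρ s.castSucc) (ρ s.succ) (entry (chain ρ f).toLinearMap s.castSucc s.succ) := by
  intro z w
  simp only [entry_apply, AlgHom.toLinearMap_apply, map_mul]
  rw [sum_triangular_succ _ _ (fun i j h => chain_lower ρ f z h) (fun i j h => chain_lower ρ f w h)]
  simp

/-! ### Entries of chains: derivations and cup-product corrections -/

variable (φ ψ χ : FreeLaurent F (Fin m) Unit →ₐ[F] R)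

/-- The derivation along `(φ, ψ)` with values `f` on the generators `a_l` and `0` on `t`. -/
def der (f : Fin m → R) : FreeLaurent F (Fin m) Unit →ₗ[F] R :=
  entry (chain ![φ, ψ] ![f]).toLinearMap 0 1

theorem der_isDer (f : Fin m → R) : IsDer φ ψ (der φ ψ f) := chain_isDer ![φ, ψ] ![f] 0

@[simp]
theorem der_gen (f : Fin m → R) (l : Fin m) : der φ ψ f (gen l) = f l := by
  simp only [der, entry_apply, AlgHom.toLinearMap_apply, chain_gen]
  exact chainGen_castSucc_succ _ _ _ 0

@[simp]
theorem der_tGen (f : Fin m → R) : der φ ψ f (tGen F m).val = 0 := by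
  simp [der]

/-- Derivations vanishing on $t$ correspond to arbitrary values on the chords, that is, to the chord
components of a morphism. -/
theorem IsDer.eq_der {φ ψ : FreeLaurent F (Fin m) Unit →ₐ[F] R}
    {δ : FreeLaurent F (Fin m) Unit →ₗ[F] R} (h : IsDer φ ψ δ) (ht : δ (tGen F m).val = 0)
    (z : FreeLaurent F (Fin m) Unit) : δ z = der φ ψ (fun l => δ (gen l)) z :=
  h.ext (der_isDer _ _ _) (by rw [ht, der_tGen]) (fun j => by rw [der_gen]) z

theorem chain_castSucc_succ (s : Fin k) (z : FreeLaurent F (Fin m) Unit) :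
    chain ρ f z s.castSucc s.succ = der (ρ s.castSucc) (ρ s.succ) (f s) z := by
  have h := (chain_isDer ρ f s).eq_der
    (by simp [Matrix.diagonal_apply_ne _ (Fin.castSucc_lt_succ).ne]) z
  simpa [chainGen_castSucc_succ] using h

theorem der_add (f g : Fin m → R) (z : FreeLaurent F (Fin m) Unit) :
    der φ ψ (f + g) z = der φ ψ f z + der φ ψ g z := by
  have h := ((der_isDer φ ψ f).add (der_isDer φ ψ g)).eq_der (by simp) z
  simp only [LinearMap.add_apply, der_gen] at h
  exact h.symm

theorem der_zero (z : FreeLaurent F (Fin m) Unit) : der φ ψ 0 z = 0 := by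
  have h := der_add φ ψ 0 0 z
  simpa using h

/-- `der` as an additive map in the values on generators. -/
def derHom (z : FreeLaurent F (Fin m) Unit) : (Fin m → R) →+ R where
  toFun f := der φ ψ f z
  map_zero' := der_zero φ ψ z
  map_add' f g := der_add φ ψ f g z

/-- The entry `(0, 2)` of a chain of length two. -/
def ter (f g : Fin m → R) : FreeLaurent F (Fin m) Unit →ₗ[F] R :=
  entry (chain ![φ, ψ, χ] ![f, g]).toLinearMap 0 2

theorem chain_two (f g : Fin m → R) (z : FreeLaurent F (Fin m) Unit) :
    chain ![φ, ψ, χ] ![f, g] z 0 1 = der φ ψ f z ∧ chain ![φ, ψ, χ] ![f, g] z 1 2 = der ψ χ g z ∧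
    chain ![φ, ψ, χ] ![f, g] z 0 2 = ter φ ψ χ f g z :=
  ⟨chain_castSucc_succ _ _ 0 z, chain_castSucc_succ _ _ 1 z, rfl⟩

theorem mul_apply_three (P Q : Matrix (Fin (2 + 1)) (Fin (2 + 1)) R) (i j : Fin (2 + 1)) :
    (P * Q) i j = P i 0 * Q 0 j + P i 1 * Q 1 j + P i 2 * Q 2 j :=
  (Matrix.mul_apply ..).trans (Fin.sum_univ_three _)

/-- The middle index of the matrix product contributes the cup product of the two derivations;
without it the corner entry would be a derivation along $(\varphi,\chi)$. -/
theorem ter_mul (f g : Fin m → R) (z w : FreeLaurent F (Fin m) Unit) :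
    ter φ ψ χ f g (z * w) = ter φ ψ χ f g z * χ w + der φ ψ f z * der ψ χ g w
      + φ z * ter φ ψ χ f g w := by
  obtain ⟨h1, -, h3⟩ := chain_two φ ψ χ f g z
  obtain ⟨-, h2', h3'⟩ := chain_two φ ψ χ f g w
  rw [← h1, ← h3, ← h2', ← h3']
  simp only [ter, entry_apply, AlgHom.toLinearMap_apply, map_mul, mul_apply_three,
    chain_self]
  simp
  abel

@[simp]
theorem ter_gen (f g : Fin m → R) (l : Fin m) : ter φ ψ χ f g (gen l) = 0 := by
  simp only [ter, entry_apply, AlgHom.toLinearMap_apply, chain_gen]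
  exact chainGen_of_ne _ _ _ _ _ (by decide) (by simp)

@[simp]
theorem ter_tGen (f g : Fin m → R) : ter φ ψ χ f g (tGen F m).val = 0 := by
  simp [ter]

/-- Two maps with the same cup-product correction differ by a derivation, so the product rule and
the values on generators characterize `ter`. -/
theorem isDer_sub_ter {φ ψ χ : FreeLaurent F (Fin m) Unit →ₐ[F] R} {f g : Fin m → R}
    {κ : FreeLaurent F (Fin m) Unit →ₗ[F] R}
    (h : ∀ z w, κ (z * w) = κ z * χ w + der φ ψ f z * der ψ χ g w + φ z * κ w) :
    IsDer φ χ (κ - ter φ ψ χ f g) := by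
  intro z w
  simp only [LinearMap.sub_apply, h, ter_mul]
  noncomm_ring

theorem eq_ter {φ ψ χ : FreeLaurent F (Fin m) Unit →ₐ[F] R} {f g : Fin m → R}
    {κ : FreeLaurent F (Fin m) Unit →ₗ[F] R}
    (h : ∀ z w, κ (z * w) = κ z * χ w + der φ ψ f z * der ψ χ g w + φ z * κ w)
    (ht : κ (tGen F m).val = 0) (hg : ∀ l, κ (gen l) = 0) (z : FreeLaurent F (Fin m) Unit) :
    κ z = ter φ ψ χ f g z :=
  sub_eq_zero.1 ((isDer_sub_ter h).eq_zero (by simp [ht]) (by simp [hg]) z)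

theorem ter_add_left (f f' g : Fin m → R) (z : FreeLaurent F (Fin m) Unit) :
    ter φ ψ χ (f + f') g z = ter φ ψ χ f g z + ter φ ψ χ f' g z := by
  refine (eq_ter (κ := ter φ ψ χ f g + ter φ ψ χ f' g) (fun z w => ?_) (by simp) (by simp) z).symm
  simp only [LinearMap.add_apply, ter_mul, der_add]
  noncomm_ring

theorem ter_add_right (f g g' : Fin m → R) (z : FreeLaurent F (Fin m) Unit) :
    ter φ ψ χ f (g + g') z = ter φ ψ χ f g z + ter φ ψ χ f g' z := by
  refine (eq_ter (κ := ter φ ψ χ f g + ter φ ψ χ f g') (fun z w => ?_) (by simp) (by simp) z).symm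
  simp only [LinearMap.add_apply, ter_mul, der_add]
  noncomm_ring

theorem ter_zero_left (g : Fin m → R) (z : FreeLaurent F (Fin m) Unit) :
    ter φ ψ χ 0 g z = 0 := by
  have h := ter_add_left φ ψ χ 0 0 g z
  simpa using h

theorem ter_zero_right (f : Fin m → R) (z : FreeLaurent F (Fin m) Unit) :
    ter φ ψ χ f 0 z = 0 := by
  have h := ter_add_right φ ψ χ f 0 0 z
  simpa using h

/-- `ter` as a biadditive map in the values on generators. -/
def terHom (z : FreeLaurent F (Fin m) Unit) : (Fin m → R) →+ (Fin m → R) →+ R :=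
  AddMonoidHom.mk' (fun f => AddMonoidHom.mk' (fun g => ter φ ψ χ f g z)
    fun g g' => ter_add_right φ ψ χ f g g' z)
    fun f f' => AddMonoidHom.ext fun g => ter_add_left φ ψ χ f f' g z

theorem terHom_apply (z : FreeLaurent F (Fin m) Unit) (f g : Fin m → R) :
    terHom φ ψ χ z f g = ter φ ψ χ f g z := rfl

/-- Chains respect the degree, if the position `i` has weight `w i`. -/
theorem chain_eq_zero_of_degree (D : ChordDGA F m) (w : Fin (k + 1) → ℤ)
    (hρ : ∀ i l, D.deg l ≠ 0 → ρ i (gen l) = 0)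
    (hf : ∀ s l, D.deg l ≠ w s.castSucc - w s.succ → f s l = 0) {p : ℤ}
    {z : FreeLaurent F (Fin m) Unit} (hz : z ∈ homogeneous D.deg p) (i j : Fin (k + 1))
    (hp : p ≠ w i - w j) : chain ρ f z i j = 0 := by
  have mul : ∀ a b : Monoid.Coprod (FreeMonoid (Fin m)) (FreeGroup Unit),
      (∀ i j, Multiplicative.toAdd (wordDeg D.deg a) ≠ w i - w j →
        chain ρ f (MonoidAlgebra.of F _ a) i j = 0) →
      (∀ i j, Multiplicative.toAdd (wordDeg D.deg b) ≠ w i - w j →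
        chain ρ f (MonoidAlgebra.of F _ b) i j = 0) →
      ∀ i j, Multiplicative.toAdd (wordDeg D.deg (a * b)) ≠ w i - w j →
        chain ρ f (MonoidAlgebra.of F _ (a * b)) i j = 0 := by
    intro a b ha hb i j h
    rw [map_mul, map_mul, Matrix.mul_apply]
    rw [map_mul, toAdd_mul] at h
    refine Finset.sum_eq_zero fun s _ => ?_
    -- Weights add along the path $i\to s\to j$: if the total degree is wrong, one of the two
    -- factors already has the wrong degree.
    by_cases hs : Multiplicative.toAdd (wordDeg D.deg a) = w i - w s
    · rw [hb s j (by omega), mul_zero]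
    · rw [ha i s hs, zero_mul]
  have one : ∀ i j : Fin (k + 1), (0 : ℤ) ≠ w i - w j →
      (1 : Matrix (Fin (k + 1)) (Fin (k + 1)) R) i j = 0 := by
    intro i j h
    refine Matrix.one_apply_ne ?_
    rintro rfl
    simp at h
  have key : ∀ a : Monoid.Coprod (FreeMonoid (Fin m)) (FreeGroup Unit), ∀ i j,
      Multiplicative.toAdd (wordDeg D.deg a) ≠ w i - w j →
        chain ρ f (MonoidAlgebra.of F _ a) i j = 0 := by
    intro a
    induction a using Monoid.Coprod.induction_on with
    | inl a =>
      induction a using FreeMonoid.inductionOn with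
      | one => simpa only [map_one, toAdd_one] using one
      | of s =>
        intro i j h
        have e : chain ρ f (MonoidAlgebra.of F _ (Monoid.Coprod.inl (FreeMonoid.of s)))
          = chainGen ρ f s := chain_gen ρ f s
        have h' : D.deg s ≠ w i - w j := by simpa [wordDeg] using h
        rw [e]
        by_cases hij : i = j
        · subst hij
          rw [chainGen_self]
          exact hρ _ _ (by simpa using h')
        · by_cases hij' : (j : ℕ) = i + 1
          · obtain ⟨r, hr, hr'⟩ : ∃ r : Fin k, i = r.castSucc ∧ j = r.succ :=
              ⟨⟨i, by have := j.2; omega⟩, Fin.ext rfl, Fin.ext hij'⟩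
            subst hr hr'
            rw [chainGen_castSucc_succ]
            exact hf _ _ h'
          · exact chainGen_of_ne _ _ _ _ _ hij hij'
      | mul a b ha hb => rw [map_mul]; exact mul _ _ ha hb
    | inr g =>
      induction g using FreeGroup.induction_on with
      | C1 => simpa only [map_one, toAdd_one] using one
      | of t =>
        intro i j h
        have e : chain ρ f (MonoidAlgebra.of F _ (Monoid.Coprod.inr (FreeGroup.of t))) = _ :=
          chain_tGen ρ f
        rw [e]
        refine Matrix.diagonal_apply_ne _ ?_
        rintro rfl
        simp [wordDeg] at h
      | inv_of t _ =>
        intro i j h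
        rw [← inv_inv_eq, chain_tGen_inv]
        refine Matrix.diagonal_apply_ne _ ?_
        rintro rfl
        simp [wordDeg] at h
      | mul a b ha hb => rw [map_mul]; exact mul _ _ ha hb
    | mul a b ha hb => exact mul _ _ ha hb
  induction hz using Submodule.span_induction with
  | mem z h =>
    obtain ⟨a, ha, rfl⟩ := h
    exact key a i j (by rw [ha]; exact hp)
  | zero => simp
  | add x y _ _ hx hy => rw [map_add, Matrix.add_apply, hx, hy, add_zero]
  | smul r x _ hx => rw [map_smul, Matrix.smul_apply, hx, smul_zero]

end Chains

variable {D : ChordDGA F m} {n : ℕ}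

/-! ### The compositions in terms of block triangular algebra maps -/

/-- The twist of the `(k+1)`-copy followed by the substitution of the letters. -/
def substHom {k : ℕ} (ρ : Fin (k + 1) → Representation D n) (c : Fin k → DualGen m)
    (M : Fin k → Matrix (Fin n) (Fin n) F) :
    CopyAlg F m (k + 1) →ₐ[F] Matrix (Fin n) (Fin n) F :=
  (TensorAlg.eval (letterValue c M)).comp (twist ρ)

section Subst

variable {k : ℕ} (ρ : Fin (k + 1) → Representation D n) (c : Fin k → DualGen m)
    (M : Fin k → Matrix (Fin n) (Fin n) F)

theorem dualTerm_eq (b : DualGen m) :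
    dualTerm ρ c M b = (substHom ρ c M).mapMatrix (D.copyD (k + 1) b) 0 (Fin.last k) := rfl

theorem letterValue_eq (g : CopyGen m (k + 1)) (i j : Fin (k + 1)) (e : DualGen m)
    (hi : g.row = i) (hj : g.col = j) (he : g.kind = e) :
    letterValue c M g = superMat (fun s => if e = c s then M s else 0) i j := by
  subst hi hj he
  simp only [letterValue, superMat, Matrix.of_apply]
  refine Finset.sum_congr rfl fun s _ => ?_
  split_ifs <;> simp_all

theorem substHom_matA (l : Fin m) :
    (substHom ρ c M).mapMatrix (matA F (k + 1) l) =
      chainGen (fun i => (ρ i).toAlgHom) (fun s l => if DualGen.a l = c s then M s else 0) l := by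
  ext1 i j
  simp only [AlgHom.mapMatrix_apply, Matrix.map_apply, matA, Matrix.of_apply, substHom,
    AlgHom.comp_apply, twist, lift_gen, map_add, TensorAlg.eval_gen, chainGen, Matrix.add_apply,
    Matrix.diagonal_apply]
  rw [add_comm, letterValue_eq c M _ _ _ _ rfl rfl rfl]
  congr 1
  split_ifs <;> simp

theorem substHom_matY :
    (substHom ρ c M).mapMatrix (matY F m (k + 1)) =
      superMat fun s => if DualGen.y = c s then M s else 0 := by
  ext1 i j
  simp only [AlgHom.mapMatrix_apply, Matrix.map_apply, matY, Matrix.of_apply]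
  by_cases h : i < j
  · rw [dif_pos h]
    simp only [substHom, AlgHom.comp_apply, twist, lift_gen, TensorAlg.eval_gen]
    exact letterValue_eq c M _ _ _ _ rfl rfl rfl
  · rw [dif_neg h, map_zero, superMat_of_ne]
    rw [Fin.lt_def] at h
    omega

/-- Morphisms of degree other than $1$ have no $x^\vee$ component. For them $X$ may be replaced by
the identity, and $\Phi(t)$ becomes diagonal. -/
theorem substHom_matX (hx : ∀ s, c s = DualGen.x → M s = 0) :
    (substHom ρ c M).mapMatrix (matX F m (k + 1)) = 1 := by
  ext1 i j
  simp only [AlgHom.mapMatrix_apply, Matrix.map_apply, matX, Matrix.of_apply]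
  by_cases h : i < j
  · rw [dif_pos h, Matrix.one_apply_ne h.ne]
    simp only [substHom, AlgHom.comp_apply, twist, lift_gen, TensorAlg.eval_gen]
    rw [letterValue_eq c M _ _ _ _ rfl rfl rfl]
    simp only [superMat, Matrix.of_apply]
    refine Finset.sum_eq_zero fun s _ => ?_
    split_ifs with h' h''
    · exact hx s h''.symm
    · rfl
    · rfl
  · rw [dif_neg h]
    by_cases e : i = j
    · subst e; simp
    · simp [e]

theorem substHom_matDelta :
    (substHom ρ c M).mapMatrix (matDelta F m (k + 1)).val =
      Matrix.diagonal fun i => (ρ i).toAlgHom (tGen F m).val := by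
  ext1 i j
  simp only [AlgHom.mapMatrix_apply, Matrix.map_apply, matDelta, Matrix.diagonal_apply]
  split_ifs
  · simp [substHom, twist]
  · simp

theorem substHom_matDelta_inv :
    (substHom ρ c M).mapMatrix ((matDelta F m (k + 1))⁻¹).val =
      Matrix.diagonal fun i => (ρ i).toAlgHom ((tGen F m)⁻¹).val := by
  change (substHom ρ c M).mapMatrix (Matrix.diagonal _) = _
  ext1 i j
  simp only [AlgHom.mapMatrix_apply, Matrix.map_apply, Matrix.diagonal_apply]
  split_ifs
  · simp only [substHom, AlgHom.comp_apply, twist, lift_inv_inv]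
    rw [← map_inv, Units.coe_map]
    simp
  · simp

/-- Both sides are algebra maps, so it suffices to compare them on $t$ and the chords. This replaces
the $N$-copy by block triangular matrices. -/
theorem substHom_copyPhi (hx : ∀ s, c s = DualGen.x → M s = 0)
    (z : FreeLaurent F (Fin m) Unit) :
    (substHom ρ c M).mapMatrix (copyPhi F m (k + 1) z) =
      chain (fun i => (ρ i).toAlgHom) (fun s l => if DualGen.a l = c s then M s else 0) z := by
  have : (substHom ρ c M).mapMatrix.comp (copyPhi F m (k + 1)) =
      chain (fun i => (ρ i).toAlgHom) (fun s l => if DualGen.a l = c s then M s else 0) := by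
    refine algHom_ext (fun l => ?_) ?_
    · rw [AlgHom.comp_apply, copyPhi, lift_gen, substHom_matA, chain_gen]
    · rw [AlgHom.comp_apply, copyPhi, lift_inv, Units.val_mul, map_mul, substHom_matDelta]
      change _ * (substHom ρ c M).mapMatrix (matX F m (k + 1)) = _
      rw [substHom_matX _ _ _ hx, mul_one, chain_tGen]
  exact DFunLike.congr_fun this z

/-- The sign $(-1)^{|a_l|}$ in $\partial A_l$ is absorbed into the parity automorphism inside
`theta`. -/
theorem dualTerm_a (hx : ∀ s, c s = DualGen.x → M s = 0) (l : Fin m) :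
    dualTerm ρ c M (.a l) = D.theta
      (chain (fun i => (ρ i).toAlgHom) (fun s l => if DualGen.a l = c s then M s else 0))
      (superMat fun s => if DualGen.y = c s then M s else 0) (gen l) 0 (Fin.last k) := by
  rw [dualTerm_eq, ChordDGA.copyD, map_sub, map_add, map_mul, map_smul, map_mul,
    substHom_copyPhi _ _ _ hx, substHom_matA, substHom_matY, ChordDGA.theta_apply, chain_gen,
    D.parity_gen, map_smul, chain_gen, smul_mul_assoc]

theorem dualTerm_x (hx : ∀ s, c s = DualGen.x → M s = 0) :
    dualTerm ρ c M .x = (ρ 0).toAlgHom ((tGen F m)⁻¹).val *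
        superMat (fun s => if DualGen.y = c s then M s else 0) 0 (Fin.last k) *
        (ρ (Fin.last k)).toAlgHom (tGen F m).val
      - superMat (fun s => if DualGen.y = c s then M s else 0) 0 (Fin.last k) := by
  rw [dualTerm_eq, ChordDGA.copyD, map_sub, map_mul, map_mul, map_mul, map_mul, substHom_matY,
    substHom_matX _ _ _ hx, substHom_matDelta, substHom_matDelta_inv, mul_one, one_mul,
    Matrix.sub_apply, Matrix.mul_diagonal, Matrix.diagonal_mul]

theorem dualTerm_y :
    dualTerm ρ c M .y = (superMat (fun s => if DualGen.y = c s then M s else 0) *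
      superMat (fun s => if DualGen.y = c s then M s else 0)) 0 (Fin.last k) := by
  rw [dualTerm_eq, ChordDGA.copyD, map_mul, substHom_matY]

end Subst

/-! ### Formula for `m_1` -/

theorem mOp_one (ρ : Fin 2 → Representation D n) (α : HomSpace F m n) (b : DualGen m) :
    mOp ρ ![α] b = ∑ e : DualGen m, dualTerm ρ ![e] ![α e] b := by
  rw [mOp, ← (Equiv.funUnique (Fin 1) (DualGen m)).symm.sum_comp]
  refine Finset.sum_congr rfl fun e _ => ?_
  have h1 : (Equiv.funUnique (Fin 1) (DualGen m)).symm e = ![e] := by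
    funext s; fin_cases s; rfl
  have h2 : (fun s => (![α] : Fin 1 → HomSpace F m n) s ((![e] : Fin 1 → DualGen m) s))
      = ![α e] := by
    funext s; fin_cases s; rfl
  have h3 : D.signExp (![e] : Fin 1 → DualGen m) = 0 := by
    simp [ChordDGA.signExp]
  rw [h1, h2, h3, zpow_zero, one_smul]

variable {ρ₁ ρ₂ ρ₃ : Representation D n}

theorem theta_zero_one {R : Type*} [Ring R] [Algebra F R]
    (φ ψ : FreeLaurent F (Fin m) Unit →ₐ[F] R) (f : Fin m → R) (y : R)
    (z : FreeLaurent F (Fin m) Unit) :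
    D.theta (chain ![φ, ψ] ![f]) (superMat ![y]) z 0 1 =
      der φ ψ f (D.d z) + y * ψ z - φ (D.parity z) * y := by
  have h : superMat ![y] 0 1 = y := superMat_castSucc_succ ![y] 0
  simp only [ChordDGA.theta_apply, Matrix.sub_apply, Matrix.add_apply]
  rw [(Matrix.mul_apply ..).trans (Fin.sum_univ_two _),
    (Matrix.mul_apply ..).trans (Fin.sum_univ_two _), h, superMat_of_ne _ _ _ (by simp),
    superMat_of_ne _ 1 1 (by simp), chain_self, chain_self]
  simp [der]

theorem m1_apply_a (α : HomSpace F m n) (hα : α .x = 0) (l : Fin m) :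
    m1 ρ₁ ρ₂ α (.a l) = der ρ₁.toAlgHom ρ₂.toAlgHom (fun j => α (.a j)) (D.d (gen l))
      + α .y * ρ₂.toAlgHom (gen l) - ρ₁.toAlgHom (D.parity (gen l)) * α .y := by
  have h (e : DualGen m) : dualTerm ![ρ₁, ρ₂] ![e] ![α e] (.a l) =
      der ρ₁.toAlgHom ρ₂.toAlgHom (fun j => if DualGen.a j = e then α e else 0) (D.d (gen l))
      + (if DualGen.y = e then α e else 0) * ρ₂.toAlgHom (gen l)
      - ρ₁.toAlgHom (D.parity (gen l)) * (if DualGen.y = e then α e else 0) := by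
    have hx : ∀ s : Fin 1, ![e] s = DualGen.x → ![α e] s = 0 := by
      intro s hs
      obtain rfl : s = 0 := Subsingleton.elim _ _
      have he : e = DualGen.x := hs
      exact he ▸ hα
    have h1 : (fun i => ((![ρ₁, ρ₂] : Fin 2 → Representation D n) i).toAlgHom) =
        ![ρ₁.toAlgHom, ρ₂.toAlgHom] := by
      funext i; match i with | 0 => rfl | 1 => rfl
    have h2 : (fun (s : Fin 1) (j : Fin m) => if DualGen.a j = ![e] s then ![α e] s else 0) =
        ![fun j => if DualGen.a j = e then α e else 0] := by
      funext i; match i with | 0 => rfl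
    have h3 : (fun (s : Fin 1) => if DualGen.y = ![e] s then ![α e] s else 0) =
        ![if DualGen.y = e then α e else 0] := by
      funext i; match i with | 0 => rfl
    rw [dualTerm_a _ _ _ hx, ← theta_zero_one, h1, h2, h3]
    rfl
  change mOp _ _ _ = _
  rw [mOp_one]
  simp only [h, Finset.sum_add_distrib, Finset.sum_sub_distrib, ← Finset.sum_mul,
    ← Finset.mul_sum, Finset.sum_ite_eq, Finset.mem_univ, if_true]
  congr 2
  -- The summand for $e$ uses only the component of $\alpha$ at $e$; additivity in the values on
  -- chords reassembles $\alpha$.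
  have := map_sum (derHom ρ₁.toAlgHom ρ₂.toAlgHom (D.d (gen l)))
    (fun e j => if DualGen.a j = e then α e else 0) Finset.univ
  refine this.symm.trans (congrArg (derHom ρ₁.toAlgHom ρ₂.toAlgHom (D.d (gen l))) ?_)
  funext j
  simp

theorem m1_apply_x (α : HomSpace F m n) (hα : α .x = 0) :
    m1 ρ₁ ρ₂ α .x = ρ₁.toAlgHom ((tGen F m)⁻¹).val * α .y * ρ₂.toAlgHom (tGen F m).val
      - α .y := by
  have h (e : DualGen m) : dualTerm ![ρ₁, ρ₂] ![e] ![α e] .x =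
      ρ₁.toAlgHom ((tGen F m)⁻¹).val * (if DualGen.y = e then α e else 0)
        * ρ₂.toAlgHom (tGen F m).val - (if DualGen.y = e then α e else 0) := by
    have hx : ∀ s : Fin 1, ![e] s = DualGen.x → ![α e] s = 0 := by
      intro s hs
      obtain rfl : s = 0 := Subsingleton.elim _ _
      have he : e = DualGen.x := hs
      exact he ▸ hα
    rw [dualTerm_x _ _ _ hx]
    have := superMat_castSucc_succ (fun s => if DualGen.y = ![e] s then ![α e] s else 0) 0
    change superMat _ 0 (Fin.last 1) = _ at this
    rw [this]
    rfl
  change mOp _ _ _ = _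
  rw [mOp_one]
  simp only [h, Finset.sum_sub_distrib, ← Finset.sum_mul,
    ← Finset.mul_sum, Finset.sum_ite_eq, Finset.mem_univ, if_true]

theorem m1_apply_y (α : HomSpace F m n) : m1 ρ₁ ρ₂ α .y = 0 := by
  change mOp _ _ _ = _
  rw [mOp_one]
  refine Finset.sum_eq_zero fun e _ => ?_
  rw [dualTerm_y]
  exact superMat_mul_superMat_of_ne _ _ _ _ (by simp)

/-! ### Formula for `m_2` in degree zero -/

theorem theta_zero_two {R : Type*} [Ring R] [Algebra F R]
    (φ ψ χ : FreeLaurent F (Fin m) Unit →ₐ[F] R) (f g : Fin m → R) (y y' : R)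
    (z : FreeLaurent F (Fin m) Unit) :
    D.theta (chain ![φ, ψ, χ] ![f, g]) (superMat ![y, y']) z 0 2 =
      ter φ ψ χ f g (D.d z) + y * der ψ χ g z - der φ ψ f (D.parity z) * y' := by
  have h : superMat ![y, y'] 0 1 = y := superMat_castSucc_succ ![y, y'] 0
  have h' : superMat ![y, y'] 1 2 = y' := superMat_castSucc_succ ![y, y'] 1
  obtain ⟨-, h2, -⟩ := chain_two φ ψ χ f g z
  obtain ⟨h1, -, -⟩ := chain_two φ ψ χ f g (D.parity z)
  obtain ⟨-, -, h3⟩ := chain_two φ ψ χ f g (D.d z)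
  simp only [ChordDGA.theta_apply, Matrix.sub_apply, Matrix.add_apply]
  rw [mul_apply_three, mul_apply_three, h1, h2, h3, h, h', superMat_of_ne _ 0 0 (by simp),
    superMat_of_ne _ 0 2 (by simp), superMat_of_ne _ 2 2 (by simp)]
  simp

/-- Only $k(k-1)/2=1$ survives in degree zero, which gives $m_2$ a global minus sign and explains
the unit $-y^\vee$. -/
theorem signExp_two (c : Fin 2 → DualGen m) (h : ∀ s, D.dualDeg (c s) = 0) :
    D.signExp c = 1 := by
  simp [ChordDGA.signExp, h]

/-- Words with a letter outside degree $0$ have a vanishing coefficient and are removed by `hd`, so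
the sign is the same for all remaining words. -/
theorem mOp_two (ρ : Fin 3 → Representation D n) (α β : HomSpace F m n) (hα : α ∈ homDeg D n 0)
    (hβ : β ∈ homDeg D n 0) (b : DualGen m)
    (hd : ∀ (c : Fin 2 → DualGen m) (M : Fin 2 → Matrix (Fin n) (Fin n) F), (∃ s, M s = 0) →
      (∀ s, c s = DualGen.x → M s = 0) → dualTerm ρ c M b = 0) :
    mOp ρ ![α, β] b = -∑ e : DualGen m, ∑ e' : DualGen m, dualTerm ρ ![e, e'] ![α e, β e'] b := by
  rw [mOp, ← Fintype.sum_prod_type', ← (finTwoArrowEquiv (DualGen m)).symm.sum_comp,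
    ← Finset.sum_neg_distrib]
  refine Finset.sum_congr rfl fun e _ => ?_
  have h1 : (finTwoArrowEquiv (DualGen m)).symm e = ![e.1, e.2] := rfl
  have h2 : (fun s => (![α, β] : Fin 2 → HomSpace F m n) s
      ((![e.1, e.2] : Fin 2 → DualGen m) s)) = ![α e.1, β e.2] := by
    funext s; fin_cases s <;> rfl
  rw [h1, h2]
  have hx : ∀ s, ![e.1, e.2] s = DualGen.x → ![α e.1, β e.2] s = 0 := by
    intro s hs
    fin_cases s
    · exact hα _ (by simp at hs; rw [hs]; simp [ChordDGA.dualDeg])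
    · exact hβ _ (by simp at hs; rw [hs]; simp [ChordDGA.dualDeg])
  by_cases h : ∃ s, ![α e.1, β e.2] s = 0
  · rw [hd _ _ h hx, smul_zero, neg_zero]
  · rw [signExp_two]
    · simp
    · intro s
      by_contra hs
      refine h ⟨s, ?_⟩
      fin_cases s
      · exact hα _ hs
      · exact hβ _ hs

section

variable (c : Fin 2 → DualGen m) (M : Fin 2 → Matrix (Fin n) (Fin n) F)

theorem dualTerm_two_a (hx : ∀ s, c s = DualGen.x → M s = 0) (l : Fin m) :
    dualTerm ![ρ₁, ρ₂, ρ₃] c M (.a l) =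
      ter ρ₁.toAlgHom ρ₂.toAlgHom ρ₃.toAlgHom (fun j => if DualGen.a j = c 0 then M 0 else 0)
        (fun j => if DualGen.a j = c 1 then M 1 else 0) (D.d (gen l))
      + (if DualGen.y = c 0 then M 0 else 0) *
        der ρ₂.toAlgHom ρ₃.toAlgHom (fun j => if DualGen.a j = c 1 then M 1 else 0) (gen l)
      - der ρ₁.toAlgHom ρ₂.toAlgHom (fun j => if DualGen.a j = c 0 then M 0 else 0)
        (D.parity (gen l)) * (if DualGen.y = c 1 then M 1 else 0) := by
  have h1 : (fun i => ((![ρ₁, ρ₂, ρ₃] : Fin 3 → Representation D n) i).toAlgHom) =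
      ![ρ₁.toAlgHom, ρ₂.toAlgHom, ρ₃.toAlgHom] := by
    funext i; match i with | 0 => rfl | 1 => rfl | 2 => rfl
  have h2 : (fun (s : Fin 2) (j : Fin m) => if DualGen.a j = c s then M s else 0) =
      ![fun j => if DualGen.a j = c 0 then M 0 else 0,
        fun j => if DualGen.a j = c 1 then M 1 else 0] := by
    funext i; match i with | 0 => rfl | 1 => rfl
  have h3 : (fun (s : Fin 2) => if DualGen.y = c s then M s else 0) =
      ![if DualGen.y = c 0 then M 0 else 0, if DualGen.y = c 1 then M 1 else 0] := by
    funext i; match i with | 0 => rfl | 1 => rfl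
  rw [dualTerm_a _ _ _ hx, ← theta_zero_two, h1, h2, h3]
  rfl

theorem dualTerm_two_y (ρ : Fin 3 → Representation D n) :
    dualTerm ρ c M .y = (if DualGen.y = c 0 then M 0 else 0) *
      (if DualGen.y = c 1 then M 1 else 0) := by
  rw [dualTerm_y, mul_apply_three, superMat_of_ne _ 0 0 (by simp), superMat_of_ne _ 0 2 (by simp)]
  have h := superMat_castSucc_succ (fun s => if DualGen.y = c s then M s else 0) 0
  have h' := superMat_castSucc_succ (fun s => if DualGen.y = c s then M s else 0) 1
  rw [zero_mul, zero_mul, add_zero, zero_add, ← h, ← h']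
  rfl

end

variable {α β : HomSpace F m n}

theorem m2_apply_a (hα : α ∈ homDeg D n 0) (hβ : β ∈ homDeg D n 0) (l : Fin m) :
    m2 ρ₁ ρ₂ ρ₃ β α (.a l) =
      -(ter ρ₁.toAlgHom ρ₂.toAlgHom ρ₃.toAlgHom (fun j => α (.a j)) (fun j => β (.a j))
          (D.d (gen l)) + α .y * β (.a l)
        - (-1 : F) ^ D.deg l • (α (.a l) * β .y)) := by
  rw [m2, mOp_two _ _ _ hα hβ]
  · have h (e e' : DualGen m) : dualTerm ![ρ₁, ρ₂, ρ₃] ![e, e'] ![α e, β e'] (.a l) =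
        ter ρ₁.toAlgHom ρ₂.toAlgHom ρ₃.toAlgHom (fun j => if DualGen.a j = e then α e else 0)
          (fun j => if DualGen.a j = e' then β e' else 0) (D.d (gen l))
        + (if DualGen.y = e then α e else 0) *
          der ρ₂.toAlgHom ρ₃.toAlgHom (fun j => if DualGen.a j = e' then β e' else 0) (gen l)
        - der ρ₁.toAlgHom ρ₂.toAlgHom (fun j => if DualGen.a j = e then α e else 0)
          (D.parity (gen l)) * (if DualGen.y = e' then β e' else 0) := dualTerm_two_a (ρ₁ := ρ₁) (ρ₂ := ρ₂) (ρ₃ := ρ₃) ![e, e']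
      ![α e, β e'] (by
        intro s hs
        fin_cases s
        · exact hα _ (by simp at hs; rw [hs]; simp [ChordDGA.dualDeg])
        · exact hβ _ (by simp at hs; rw [hs]; simp [ChordDGA.dualDeg])) l
    simp only [D.parity_gen, map_smul, der_gen] at h
    simp only [h, Finset.sum_add_distrib, Finset.sum_sub_distrib, smul_mul_assoc,
      ← Finset.smul_sum, ← Finset.sum_mul_sum, Finset.sum_ite_eq, Finset.mem_univ, if_true]
    congr 3
    have e1 : (∑ e, fun j => if DualGen.a j = e then α e else 0) = fun j => α (.a j) := by
      funext j; simp
    have e2 : (∑ e, fun j => if DualGen.a j = e then β e else 0) = fun j => β (.a j) := by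
      funext j; simp
    rw [← terHom_apply, ← e1, map_sum, AddMonoidHom.finsetSum_apply]
    refine Finset.sum_congr rfl fun e _ => ?_
    rw [← e2, map_sum]
    rfl
  · rintro c M hs hx
    rw [dualTerm_two_a _ _ hx]
    rw [Fin.exists_fin_two] at hs
    have e0 : (fun _ => 0 : Fin m → Matrix (Fin n) (Fin n) F) = 0 := rfl
    rcases hs with hs | hs
    · simp only [hs, ite_self, e0, ter_zero_left, der_zero, zero_mul, add_zero, sub_zero]
    · simp only [hs, ite_self, e0, ter_zero_right, der_zero, mul_zero, add_zero, sub_zero]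

theorem m2_apply_y (hα : α ∈ homDeg D n 0) (hβ : β ∈ homDeg D n 0) :
    m2 ρ₁ ρ₂ ρ₃ β α .y = -(α .y * β .y) := by
  rw [m2, mOp_two _ _ _ hα hβ]
  · have h (e e' : DualGen m) : dualTerm ![ρ₁, ρ₂, ρ₃] ![e, e'] ![α e, β e'] .y =
        (if DualGen.y = e then α e else 0) * (if DualGen.y = e' then β e' else 0) :=
      dualTerm_two_y ![e, e'] ![α e, β e'] ![ρ₁, ρ₂, ρ₃]
    simp only [h, ← Finset.sum_mul_sum,
      Finset.sum_ite_eq, Finset.mem_univ, if_true]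
  · rintro c M hs -
    rw [dualTerm_two_y]
    rw [Fin.exists_fin_two] at hs
    rcases hs with hs | hs <;> simp [hs]

theorem m2_apply_x (hα : α ∈ homDeg D n 0) (hβ : β ∈ homDeg D n 0) :
    m2 ρ₁ ρ₂ ρ₃ β α .x = 0 := by
  have h : ∀ (c : Fin 2 → DualGen m) (M : Fin 2 → Matrix (Fin n) (Fin n) F),
      (∀ s, c s = DualGen.x → M s = 0) → dualTerm ![ρ₁, ρ₂, ρ₃] c M .x = 0 := by
    intro c M hx
    rw [dualTerm_x _ _ _ hx, superMat_of_ne _ _ _ (by simp)]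
    simp
  rw [m2, mOp_two _ _ _ hα hβ _ fun c M _ hx => h c M hx, neg_eq_zero]
  refine Finset.sum_eq_zero fun e _ => Finset.sum_eq_zero fun e' _ => h _ _ fun s hs => ?_
  fin_cases s
  · exact hα _ (by simp at hs; rw [hs]; simp [ChordDGA.dualDeg])
  · exact hβ _ (by simp at hs; rw [hs]; simp [ChordDGA.dualDeg])

/-! ### Parity and degree of the entries of chains -/

section Parity

variable {R : Type*} [Ring R] [Algebra F R]

theorem IsDer.smul {φ ψ : FreeLaurent F (Fin m) Unit →ₐ[F] R}
    {δ : FreeLaurent F (Fin m) Unit →ₗ[F] R} (h : IsDer φ ψ δ) (r : F) : IsDer φ ψ (r • δ) := by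
  intro z w
  simp only [LinearMap.smul_apply, h z w, smul_add, smul_mul_assoc, mul_smul_comm]

variable {φ ψ χ : FreeLaurent F (Fin m) Unit →ₐ[F] R}

theorem der_parity (hφ : ∀ z, φ (D.parity z) = φ z) (hψ : ∀ z, ψ (D.parity z) = ψ z)
    {f : Fin m → R} {p : ℤ} (hf : ∀ l, D.deg l ≠ p → f l = 0) (z : FreeLaurent F (Fin m) Unit) :
    der φ ψ f (D.parity z) = (-1 : F) ^ p • der φ ψ f z := by
  refine IsDer.ext (φ := φ) (ψ := ψ) (δ := der φ ψ f ∘ₗ D.parity.toLinearMap)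
    (δ' := (-1 : F) ^ p • der φ ψ f) ?_ ((der_isDer φ ψ f).smul _) ?_ ?_ z
  · intro z w
    simp only [LinearMap.comp_apply, AlgHom.toLinearMap_apply, map_mul, der_isDer φ ψ f _ _, hφ, hψ]
  · simp
  · intro l
    simp only [LinearMap.comp_apply, AlgHom.toLinearMap_apply, D.parity_gen, map_smul, der_gen,
      LinearMap.smul_apply]
    by_cases h : D.deg l = p
    · rw [h]
    · rw [hf l h, smul_zero, smul_zero]

/-- Each of the two factors in the cup product changes sign under parity, and the two signs cancel.
-/
theorem ter_parity (hφ : ∀ z, φ (D.parity z) = φ z) (hψ : ∀ z, ψ (D.parity z) = ψ z)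
    (hχ : ∀ z, χ (D.parity z) = χ z) {f g : Fin m → R} (hf : ∀ l, D.deg l ≠ -1 → f l = 0)
    (hg : ∀ l, D.deg l ≠ -1 → g l = 0) (z : FreeLaurent F (Fin m) Unit) :
    ter φ ψ χ f g (D.parity z) = ter φ ψ χ f g z := by
  refine eq_ter (κ := ter φ ψ χ f g ∘ₗ D.parity.toLinearMap) (fun z w => ?_) (by simp) (by simp) z
  simp only [LinearMap.comp_apply, AlgHom.toLinearMap_apply, map_mul, ter_mul, hφ, hχ,
    der_parity hφ hψ hf, der_parity hψ hχ hg]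
  simp

theorem der_eq_zero_of_degree (hφ : ∀ l, D.deg l ≠ 0 → φ (gen l) = 0)
    (hψ : ∀ l, D.deg l ≠ 0 → ψ (gen l) = 0) {f : Fin m → R} {p : ℤ}
    (hf : ∀ l, D.deg l ≠ p → f l = 0) {q : ℤ} {z : FreeLaurent F (Fin m) Unit}
    (hz : z ∈ homogeneous D.deg q) (h : q ≠ p) : der φ ψ f z = 0 := by
  -- The weights are chosen with successive differences equal to the degrees of the values on
  -- chords, here $p$.
  refine chain_eq_zero_of_degree ![φ, ψ] ![f] D ![p, 0] ?_ ?_ hz 0 1 (by simpa using h)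
  · intro i l hl
    match i with
    | 0 => exact hφ l hl
    | 1 => exact hψ l hl
  · intro s l hl
    match s with
    | 0 => exact hf l (by simpa using hl)

theorem ter_eq_zero_of_degree (hφ : ∀ l, D.deg l ≠ 0 → φ (gen l) = 0)
    (hψ : ∀ l, D.deg l ≠ 0 → ψ (gen l) = 0) (hχ : ∀ l, D.deg l ≠ 0 → χ (gen l) = 0)
    {f g : Fin m → R} {p p' : ℤ}
    (hf : ∀ l, D.deg l ≠ p → f l = 0) (hg : ∀ l, D.deg l ≠ p' → g l = 0) {q : ℤ}
    {z : FreeLaurent F (Fin m) Unit}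
    (hz : z ∈ homogeneous D.deg q) (h : q ≠ p + p') : ter φ ψ χ f g z = 0 := by
  refine chain_eq_zero_of_degree ![φ, ψ, χ] ![f, g] D ![p + p', p', 0] ?_ ?_ hz 0 2
    (by simpa using h)
  · intro i l hl
    match i with
    | 0 => exact hφ l hl
    | 1 => exact hψ l hl
    | 2 => exact hχ l hl
  · intro s l hl
    match s with
    | 0 => exact hf l (by simpa using hl)
    | 1 => exact hg l (by simpa using hl)

end Parity

/-! ### Degree zero morphisms -/

/-- The values of a morphism on the dual chords. -/
abbrev chords (α : HomSpace F m n) : Fin m → Matrix (Fin n) (Fin n) F := fun l => α (.a l)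

/-- The morphism with given values on the dual chords and `0` on `x^∨` and `y^∨`. -/
def ofChords (f : Fin m → Matrix (Fin n) (Fin n) F) : HomSpace F m n
  | .a l => f l
  | .x => 0
  | .y => 0

namespace Representation

theorem ext_toAlgHom {ρ ρ' : Representation D n} (h : ρ.toAlgHom = ρ'.toAlgHom) : ρ = ρ' := by
  cases ρ; cases ρ'; congr

@[simp]
theorem map_parity (ρ : Representation D n) (z : FreeLaurent F (Fin m) Unit) :
    ρ.toAlgHom (D.parity z) = ρ.toAlgHom z := by
  have : ρ.toAlgHom.comp D.parity = ρ.toAlgHom := by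
    refine algHom_ext (fun l => ?_) (by simp)
    rw [AlgHom.comp_apply, D.parity_gen, map_smul]
    by_cases h : D.deg l = 0
    · simp [h]
    · simp [ρ.map_gen l h]
  exact DFunLike.congr_fun this z

end Representation

variable {ρ₁ ρ₂ ρ₃ ρ₄ : Representation D n} {α β γ δ : HomSpace F m n}

/-- The shift $|a^\vee|=|a|+1$: morphisms of degree $0$ and $-1$ are supported on chords of degree
$-1$ and $-2$. -/
theorem chords_eq_zero {p : ℤ} (h : α ∈ homDeg D n (p + 1)) (l : Fin m) (hl : D.deg l ≠ p) :
    chords α l = 0 :=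
  h _ fun e => hl (by simpa [ChordDGA.dualDeg] using e)

theorem chords_eq_zero' (h : α ∈ homDeg D n 0) (l : Fin m) (hl : D.deg l ≠ -1) :
    chords α l = 0 :=
  chords_eq_zero (p := -1) h l hl

theorem x_eq_zero {p : ℤ} (h : α ∈ homDeg D n p) (hp : p ≠ 1) : α .x = 0 := h _ hp.symm

theorem y_eq_zero {p : ℤ} (h : α ∈ homDeg D n p) (hp : p ≠ 0) : α .y = 0 := h _ hp.symm

theorem ofChords_mem {f : Fin m → Matrix (Fin n) (Fin n) F} {p : ℤ}
    (h : ∀ l, D.deg l ≠ p → f l = 0) : ofChords f ∈ homDeg D n (p + 1) := by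
  intro c hc
  cases c with
  | a l => exact h l fun e => hc (by simp [ChordDGA.dualDeg, e])
  | x => rfl
  | y => rfl

/-- The derivation given by a morphism. -/
abbrev hder (ρ₁ ρ₂ : Representation D n) (α : HomSpace F m n) :=
  der ρ₁.toAlgHom ρ₂.toAlgHom (chords α)

theorem hder_mul (α : HomSpace F m n) (z w : FreeLaurent F (Fin m) Unit) :
    hder ρ₁ ρ₂ α (z * w) = hder ρ₁ ρ₂ α z * ρ₂.toAlgHom w + ρ₁.toAlgHom z * hder ρ₁ ρ₂ α w :=
  der_isDer _ _ _ z w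

theorem hder_parity (h : α ∈ homDeg D n 0) (z : FreeLaurent F (Fin m) Unit) :
    hder ρ₁ ρ₂ α (D.parity z) = -hder ρ₁ ρ₂ α z := by
  rw [hder, der_parity ρ₁.map_parity ρ₂.map_parity (chords_eq_zero' h)]
  simp

theorem hder_parity' (h : α ∈ homDeg D n (-1)) (z : FreeLaurent F (Fin m) Unit) :
    hder ρ₁ ρ₂ α (D.parity z) = hder ρ₁ ρ₂ α z := by
  rw [hder, der_parity ρ₁.map_parity ρ₂.map_parity (chords_eq_zero (p := -2) h)]
  simp

/-- The bilinear extension of two composable morphisms. -/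
abbrev hter (ρ₁ ρ₂ ρ₃ : Representation D n) (α β : HomSpace F m n) :=
  ter ρ₁.toAlgHom ρ₂.toAlgHom ρ₃.toAlgHom (chords α) (chords β)

theorem hter_mul (α β : HomSpace F m n) (z w : FreeLaurent F (Fin m) Unit) :
    hter ρ₁ ρ₂ ρ₃ α β (z * w) = hter ρ₁ ρ₂ ρ₃ α β z * ρ₃.toAlgHom w
      + hder ρ₁ ρ₂ α z * hder ρ₂ ρ₃ β w + ρ₁.toAlgHom z * hter ρ₁ ρ₂ ρ₃ α β w :=
  ter_mul _ _ _ _ _ z w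

theorem m1_chord (hα : α .x = 0) (l : Fin m) :
    m1 ρ₁ ρ₂ α (.a l) = hder ρ₁ ρ₂ α (D.d (gen l))
      + α .y * ρ₂.toAlgHom (gen l) - ρ₁.toAlgHom (gen l) * α .y := by
  rw [m1_apply_a α hα, ρ₁.map_parity]

/-- The $x^\vee$ component of $m_1\alpha$ is $\rho_1(t)^{-1}\alpha_y\rho_2(t)-\alpha_y$; multiplying
by $\rho_1(t)$ turns its vanishing into an intertwining relation. The $y^\vee$ component of
$m_1\alpha$ is always zero. -/
theorem mem_cocycles_iff : α ∈ cocycles ρ₁ ρ₂ ↔ α ∈ homDeg D n 0 ∧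
    (∀ l, hder ρ₁ ρ₂ α (D.d (gen l)) + α .y * ρ₂.toAlgHom (gen l)
      - ρ₁.toAlgHom (gen l) * α .y = 0) ∧
    α .y * ρ₂.toAlgHom (tGen F m).val = ρ₁.toAlgHom (tGen F m).val * α .y := by
  rw [cocycles, Submodule.mem_inf, LinearMap.mem_ker]
  refine and_congr_right fun h => ?_
  have hx := x_eq_zero h (by simp)
  have ht : m1 ρ₁ ρ₂ α .x = 0 ↔
      α .y * ρ₂.toAlgHom (tGen F m).val = ρ₁.toAlgHom (tGen F m).val * α .y := by
    rw [← sub_eq_zero (b := _ * α .y), m1_apply_x α hx, ← map_eq_zero_iff ρ₁.toAlgHom () (_ - _),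
      mul_sub, ← mul_assoc, ← mul_assoc, ← map_mul, Units.mul_inv, map_one, one_mul]
  constructor
  · intro h0
    refine ⟨fun l => ?_, ht.1 (congrFun h0 _)⟩
    rw [← m1_chord hx, h0]
    rfl
  · rintro ⟨h1, h2⟩
    funext c
    cases c with
    | a l => rw [m1_chord hx, h1]; rfl
    | x => exact ht.2 h2
    | y => exact m1_apply_y α

/-- A cocycle of degree `0` is a chain homotopy. -/
theorem cocycle_homotopy (h : α ∈ cocycles ρ₁ ρ₂) (z : FreeLaurent F (Fin m) Unit) :
    hder ρ₁ ρ₂ α (D.d z) = ρ₁.toAlgHom z * α .y - α .y * ρ₂.toAlgHom z := by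
  obtain ⟨-, h1, h2⟩ := mem_cocycles_iff.1 h
  -- The defect of the homotopy relation is a derivation, because $\rho_1\partial=\rho_2\partial=0$
  -- kills the cross terms of the Leibniz rule.
  have key : IsDer ρ₁.toAlgHom ρ₂.toAlgHom (hder ρ₁ ρ₂ α ∘ₗ D.d
      + LinearMap.mulLeft F (α .y) ∘ₗ ρ₂.toAlgHom.toLinearMap
      - LinearMap.mulRight F (α .y) ∘ₗ ρ₁.toAlgHom.toLinearMap) := by
    intro z w
    simp only [LinearMap.sub_apply, LinearMap.add_apply, LinearMap.comp_apply, D.d_mul_parity,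
      map_add, hder_mul, ρ₁.map_d, ρ₂.map_d, ρ₁.map_parity, LinearMap.mulLeft_apply,
      LinearMap.mulRight_apply, AlgHom.toLinearMap_apply, map_mul]
    noncomm_ring
  have := key.eq_zero (by simp [D.d_tGen, h2]) (fun l => by simpa using h1 l) z
  simp only [LinearMap.sub_apply, LinearMap.add_apply, LinearMap.comp_apply,
    LinearMap.mulLeft_apply, LinearMap.mulRight_apply, AlgHom.toLinearMap_apply] at this
  rw [← sub_eq_zero, ← this]
  abel

/-! ### Composition of cocycles -/

/-- The obstruction to `hter` being a chain homotopy. -/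
def homotopyDefect (ρ₁ ρ₂ ρ₃ : Representation D n) (α β : HomSpace F m n) :
    FreeLaurent F (Fin m) Unit →ₗ[F] Matrix (Fin n) (Fin n) F :=
  hter ρ₁ ρ₂ ρ₃ α β ∘ₗ D.d + LinearMap.mulLeft F (α .y) ∘ₗ hder ρ₂ ρ₃ β
    - LinearMap.mulRight F (β .y) ∘ₗ hder ρ₁ ρ₂ α ∘ₗ D.parity.toLinearMap

theorem homotopyDefect_apply (z : FreeLaurent F (Fin m) Unit) :
    homotopyDefect ρ₁ ρ₂ ρ₃ α β z = hter ρ₁ ρ₂ ρ₃ α β (D.d z) + α .y * hder ρ₂ ρ₃ β z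
      - hder ρ₁ ρ₂ α (D.parity z) * β .y := rfl

theorem m2_chord (hα : α ∈ homDeg D n 0) (hβ : β ∈ homDeg D n 0) (l : Fin m) :
    m2 ρ₁ ρ₂ ρ₃ β α (.a l) = -homotopyDefect ρ₁ ρ₂ ρ₃ α β (gen l) := by
  rw [m2_apply_a hα hβ, homotopyDefect_apply, D.parity_gen, map_smul, der_gen, der_gen,
    smul_mul_assoc]

theorem m2_mem_homDeg (hα : α ∈ homDeg D n 0) (hβ : β ∈ homDeg D n 0) :
    m2 ρ₁ ρ₂ ρ₃ β α ∈ homDeg D n 0 := by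
  intro c hc
  cases c with
  | a l =>
    have hl : D.deg l ≠ -1 := fun e => hc (by simp [ChordDGA.dualDeg, e])
    rw [m2_apply_a hα hβ, ter_eq_zero_of_degree ρ₁.map_gen ρ₂.map_gen ρ₃.map_gen
      (chords_eq_zero' hα) (chords_eq_zero' hβ) (D.d_gen_mem l) (by omega)]
    have h1 := chords_eq_zero' hα l hl
    have h2 := chords_eq_zero' hβ l hl
    simp only [chords] at h1 h2
    simp [h1, h2]
  | x => exact m2_apply_x hα hβ
  | y => exact absurd rfl hc

/-- The cup-product terms contain one derivation evaluated on a boundary. The homotopy relations of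
$\alpha$ and $\beta$ turn these into commutator-like terms, which cancel the cross terms from
multiplication by $\alpha_y$ and $\beta_y$. -/
theorem homotopyDefect_isDer (hα : α ∈ cocycles ρ₁ ρ₂) (hβ : β ∈ cocycles ρ₂ ρ₃) :
    IsDer ρ₁.toAlgHom ρ₃.toAlgHom (homotopyDefect ρ₁ ρ₂ ρ₃ α β) := by
  intro z w
  simp only [homotopyDefect_apply, D.d_mul_parity, map_add, hter_mul, hder_mul, ρ₁.map_d, ρ₃.map_d,
    ρ₁.map_parity, ρ₂.map_parity, map_mul, cocycle_homotopy hα, cocycle_homotopy hβ]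
  noncomm_ring

theorem homotopyDefect_d (hα : α ∈ cocycles ρ₁ ρ₂) (hβ : β ∈ cocycles ρ₂ ρ₃)
    (z : FreeLaurent F (Fin m) Unit) :
    homotopyDefect ρ₁ ρ₂ ρ₃ α β (D.d z) =
      ρ₁.toAlgHom z * (α .y * β .y) - α .y * β .y * ρ₃.toAlgHom z := by
  rw [homotopyDefect_apply, D.d_d, map_zero, hder_parity hα.1, cocycle_homotopy hα,
    cocycle_homotopy hβ]
  noncomm_ring

/-- Two derivations agreeing on generators: the formula for $m_2$ on chords thereby extends to the
whole algebra and can be evaluated on boundaries. -/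
theorem homotopyDefect_eq (hα : α ∈ cocycles ρ₁ ρ₂) (hβ : β ∈ cocycles ρ₂ ρ₃)
    (z : FreeLaurent F (Fin m) Unit) :
    homotopyDefect ρ₁ ρ₂ ρ₃ α β z = -hder ρ₁ ρ₃ (m2 ρ₁ ρ₂ ρ₃ β α) z := by
  have h := (homotopyDefect_isDer hα hβ).add
    (der_isDer ρ₁.toAlgHom ρ₃.toAlgHom (chords (m2 ρ₁ ρ₂ ρ₃ β α)))
  refine eq_neg_of_add_eq_zero_left (h.eq_zero ?_ (fun l => ?_) z)
  · simp [homotopyDefect_apply, D.d_tGen]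
  · simp [m2_chord hα.1 hβ.1]

/-- Evaluating the extended formula for $m_2$ on $\partial a_l$, where the `hter` term drops out by
$\partial^2=0$, gives the cocycle equation. -/
theorem m2_mem_cocycles (hα : α ∈ cocycles ρ₁ ρ₂) (hβ : β ∈ cocycles ρ₂ ρ₃) :
    m2 ρ₁ ρ₂ ρ₃ β α ∈ cocycles ρ₁ ρ₃ := by
  refine mem_cocycles_iff.2 ⟨m2_mem_homDeg hα.1 hβ.1, fun l => ?_, ?_⟩
  · have h := homotopyDefect_d hα hβ (gen l)
    rw [homotopyDefect_eq hα hβ, neg_eq_iff_eq_neg] at h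
    rw [h, m2_apply_y hα.1 hβ.1]
    noncomm_ring
  · obtain ⟨-, -, h1⟩ := mem_cocycles_iff.1 hα
    obtain ⟨-, -, h2⟩ := mem_cocycles_iff.1 hβ
    rw [m2_apply_y hα.1 hβ.1, neg_mul, mul_assoc, h2, ← mul_assoc, h1, mul_assoc, mul_neg]

/-! ### Cancellation for composition, and the unit -/

theorem hter_eqOn_below {α' β' : HomSpace F m n} {l : Fin m}
    (hα : ∀ j < l, α (.a j) = α' (.a j)) (hβ : ∀ j < l, β (.a j) = β' (.a j)) :
    hter ρ₁ ρ₂ ρ₃ α β (D.d (gen l)) = hter ρ₁ ρ₂ ρ₃ α' β' (D.d (gen l)) := by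
  refine congrFun (congrFun (chain_eqOn_below _ _ _ _ (fun _ => rfl) (fun _ _ _ => rfl) ?_
    (D.d_height l)) _) _
  intro s j hj
  match s with
  | 0 => exact hα j hj
  | 1 => exact hβ j hj

/-- At $a_l$ the composite is, up to sign, $\alpha_y\beta(a_l)$ plus terms in $\beta_y$ and the
values of $\beta$ on lower chords. Thus composition is triangular in height, and $\beta$ is
recovered recursively. -/
theorem m2_left_injective {β' : HomSpace F m n} (hα : α ∈ homDeg D n 0) (hy : IsUnit (α .y))
    (hβ : β ∈ homDeg D n 0) (hβ' : β' ∈ homDeg D n 0)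
    (h : m2 ρ₁ ρ₂ ρ₃ β α = m2 ρ₁ ρ₂ ρ₃ β' α) : β = β' := by
  have h0 : β .y = β' .y := by
    have := congrFun h .y
    rw [m2_apply_y hα hβ, m2_apply_y hα hβ', neg_inj] at this
    exact hy.mul_left_cancel this
  have h1 : ∀ l, β (.a l) = β' (.a l) := by
    intro l
    induction l using WellFoundedLT.induction with
    | ind l ih =>
      have := congrFun h (.a l)
      rw [m2_apply_a hα hβ, m2_apply_a hα hβ', neg_inj, h0, sub_left_inj] at this
      have h3 := hter_eqOn_below (ρ₁ := ρ₁) (ρ₂ := ρ₂) (ρ₃ := ρ₃) (α := α) (fun _ _ => rfl) ih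
      rw [h3] at this
      exact hy.mul_left_cancel (add_left_cancel this)
  funext c
  cases c with
  | a l => exact h1 l
  | x => rw [x_eq_zero hβ (by simp), x_eq_zero hβ' (by simp)]
  | y => exact h0

theorem m2_right_injective {α' : HomSpace F m n} (hβ : β ∈ homDeg D n 0) (hy : IsUnit (β .y))
    (hα : α ∈ homDeg D n 0) (hα' : α' ∈ homDeg D n 0)
    (h : m2 ρ₁ ρ₂ ρ₃ β α = m2 ρ₁ ρ₂ ρ₃ β α') : α = α' := by
  have h0 : α .y = α' .y := by
    have := congrFun h .y
    rw [m2_apply_y hα hβ, m2_apply_y hα' hβ, neg_inj] at this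
    exact hy.mul_right_cancel this
  have h1 : ∀ l, α (.a l) = α' (.a l) := by
    intro l
    induction l using WellFoundedLT.induction with
    | ind l ih =>
      have := congrFun h (.a l)
      have h3 := hter_eqOn_below (ρ₁ := ρ₁) (ρ₂ := ρ₂) (ρ₃ := ρ₃) (β := β) ih (fun _ _ => rfl)
      rw [m2_apply_a hα hβ, m2_apply_a hα' hβ, neg_inj, h0, h3, sub_right_inj] at this
      -- On this side the leading term carries the factor $(-1)^{|a_l|}$, which is nonzero.
      exact hy.mul_right_cancel (smul_right_injective _ (zpow_ne_zero _ (by simp)) this)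
  funext c
  cases c with
  | a l => exact h1 l
  | x => rw [x_eq_zero hα (by simp), x_eq_zero hα' (by simp)]
  | y => exact h0

theorem unitHom_mem (ρ : Representation D n) : unitHom F m n ∈ cocycles ρ ρ := by
  have h0 : chords (unitHom F m n) = 0 := rfl
  have hy : unitHom F m n .y = -1 := by simp [unitHom]
  refine mem_cocycles_iff.2 ⟨?_, fun l => ?_, ?_⟩
  · intro c hc
    cases c with
    | a l => rfl
    | x => rfl
    | y => exact absurd rfl hc
  · rw [hder, h0, der_zero, hy]; simp
  · rw [hy]; simp

/-! ### Coboundaries -/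

theorem m1_chord_of_degree (hδ : δ ∈ homDeg D n (-1)) (l : Fin m) :
    m1 ρ₁ ρ₂ δ (.a l) = hder ρ₁ ρ₂ δ (D.d (gen l)) := by
  rw [m1_chord (x_eq_zero hδ (by simp)), y_eq_zero hδ (by simp)]
  simp

theorem m1_x_of_degree (hδ : δ ∈ homDeg D n (-1)) : m1 ρ₁ ρ₂ δ .x = 0 := by
  rw [m1_apply_x _ (x_eq_zero hδ (by simp)), y_eq_zero hδ (by simp)]
  simp

/-- In degree $-1$ there is no $y^\vee$ component, and composing a derivation along representations
with $\partial$ gives a derivation when its values have even degree. -/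
theorem hder_m1 (hδ : δ ∈ homDeg D n (-1)) (z : FreeLaurent F (Fin m) Unit) :
    hder ρ₁ ρ₂ (m1 ρ₁ ρ₂ δ) z = hder ρ₁ ρ₂ δ (D.d z) := by
  have key : IsDer ρ₁.toAlgHom ρ₂.toAlgHom (hder ρ₁ ρ₂ δ ∘ₗ D.d) := by
    intro z w
    simp only [LinearMap.comp_apply, D.d_mul_parity, map_add, hder_mul, ρ₁.map_d, ρ₂.map_d,
      ρ₁.map_parity]
    noncomm_ring
  refine (der_isDer _ _ _).ext key ?_ (fun l => ?_) z
  · simp [D.d_tGen]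
  · simp [m1_chord_of_degree hδ]

theorem coboundaries_y (h : α ∈ coboundaries ρ₁ ρ₂) : α .y = 0 := by
  obtain ⟨δ, -, rfl⟩ := h
  exact m1_apply_y δ

theorem coboundaries_le : coboundaries ρ₁ ρ₂ ≤ cocycles ρ₁ ρ₂ := by
  rintro _ ⟨δ, hδ, rfl⟩
  have hδ : δ ∈ homDeg D n (-1) := hδ
  have hy : m1 ρ₁ ρ₂ δ .y = 0 := m1_apply_y δ
  refine mem_cocycles_iff.2 ⟨?_, fun l => ?_, ?_⟩
  · intro c hc
    cases c with
    | a l =>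
      have hl : D.deg l ≠ -1 := fun e => hc (by simp [ChordDGA.dualDeg, e])
      rw [m1_chord_of_degree hδ]
      exact der_eq_zero_of_degree ρ₁.map_gen ρ₂.map_gen (chords_eq_zero (p := -2) hδ)
        (D.d_gen_mem l) (by omega)
    | x => exact m1_x_of_degree hδ
    | y => exact absurd rfl hc
  · rw [hder_m1 hδ, D.d_d, hy]
    simp
  · rw [hy]
    simp

/-- Composition with a cocycle preserves the relation of being cohomologous. -/
theorem m2_sub_m2_mem {β' : HomSpace F m n} (hα : α ∈ cocycles ρ₂ ρ₃) (hβ : β ∈ cocycles ρ₁ ρ₂)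
    (hβ' : β' ∈ cocycles ρ₁ ρ₂) (h : β' - β ∈ coboundaries ρ₁ ρ₂) :
    m2 ρ₁ ρ₂ ρ₃ α β - m2 ρ₁ ρ₂ ρ₃ α β' ∈ coboundaries ρ₁ ρ₃ := by
  have hy : β' .y = β .y := sub_eq_zero.1 (coboundaries_y h)
  obtain ⟨δ, hδ, hm⟩ := h
  have hδ : δ ∈ homDeg D n (-1) := hδ
  obtain rfl : β' = β + m1 ρ₁ ρ₂ δ := by rw [hm]; abel
  have hd (z) : hder ρ₁ ρ₂ (β + m1 ρ₁ ρ₂ δ) z = hder ρ₁ ρ₂ β z + hder ρ₁ ρ₂ δ (D.d z) := by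
    rw [← hder_m1 hδ]
    exact der_add _ _ _ _ z
  -- On chords $G$ is, up to sign, the composite of $\alpha$ with $\delta$: the two leading `hter`
  -- terms vanish there. They are included to cancel the cup-product corrections and make $G$ a
  -- derivation on the whole algebra.
  let G : FreeLaurent F (Fin m) Unit →ₗ[F] Matrix (Fin n) (Fin n) F :=
    hter ρ₁ ρ₂ ρ₃ β α - hter ρ₁ ρ₂ ρ₃ (β + m1 ρ₁ ρ₂ δ) α + hter ρ₁ ρ₂ ρ₃ δ α ∘ₗ D.d
      - LinearMap.mulRight F (α .y) ∘ₗ hder ρ₁ ρ₂ δ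
  have hG (z) : G z = hter ρ₁ ρ₂ ρ₃ β α z - hter ρ₁ ρ₂ ρ₃ (β + m1 ρ₁ ρ₂ δ) α z
      + hter ρ₁ ρ₂ ρ₃ δ α (D.d z) - hder ρ₁ ρ₂ δ z * α .y := rfl
  have key : IsDer ρ₁.toAlgHom ρ₃.toAlgHom G := by
    intro z w
    simp only [hG, D.d_mul_parity, map_add, hter_mul, hder_mul, hd, ρ₁.map_d, ρ₃.map_d,
      ρ₁.map_parity, hder_parity' hδ, cocycle_homotopy hα]
    noncomm_ring
  have hGd (z) := key.eq_der (by simp [hG, D.d_tGen]) z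
  have hε : ofChords (fun l => G (gen l)) ∈ homDeg D n (-1) :=
    ofChords_mem (p := -2) fun l hl => by
      have h1 := chords_eq_zero (p := -2) hδ l hl
      rw [hG, ter_gen, ter_gen, ter_eq_zero_of_degree ρ₁.map_gen ρ₂.map_gen ρ₃.map_gen
        (chords_eq_zero (p := -2) hδ) (chords_eq_zero' hα.1) (D.d_gen_mem l) (by omega), der_gen,
        h1]
      simp
  refine ⟨-ofChords fun l => G (gen l), Submodule.neg_mem _ hε, ?_⟩
  rw [map_neg]
  funext c
  cases c with
  | a l =>
    rw [Pi.neg_apply, m1_chord_of_degree hε]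
    change -der ρ₁.toAlgHom ρ₃.toAlgHom (fun l => G (gen l)) _ = _
    rw [← hGd, hG, D.d_d, map_zero, Pi.sub_apply, m2_apply_a hβ.1 hα.1, m2_apply_a hβ'.1 hα.1,
      hy, Pi.add_apply, m1_chord_of_degree hδ]
    -- The sign $(-1)^{|a_l|}$ matters only for chords of degree $-1$; elsewhere the term it
    -- multiplies is zero.
    by_cases hl : D.deg l = -1
    · rw [hl]
      simp
      noncomm_ring
    · rw [der_eq_zero_of_degree ρ₁.map_gen ρ₂.map_gen (chords_eq_zero (p := -2) hδ)
        (D.d_gen_mem l) (by omega)]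
      simp
      abel
  | x =>
    rw [Pi.neg_apply, Pi.sub_apply, m1_x_of_degree hε, m2_apply_x hβ.1 hα.1,
      m2_apply_x hβ'.1 hα.1]
    simp
  | y =>
    rw [Pi.neg_apply, Pi.sub_apply, m1_apply_y, m2_apply_y hβ.1 hα.1,
      m2_apply_y hβ'.1 hα.1, hy]
    simp

/-! ### Chains of length three -/

section Quat

variable {R : Type*} [Ring R] [Algebra F R] (φ ψ χ ω : FreeLaurent F (Fin m) Unit →ₐ[F] R)
  (f g h : Fin m → R)

/-- The entry `(0, 3)` of a chain of length three. -/
def quat : FreeLaurent F (Fin m) Unit →ₗ[F] R :=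
  entry (chain ![φ, ψ, χ, ω] ![f, g, h]).toLinearMap 0 3

theorem mul_apply_four (P Q : Matrix (Fin (3 + 1)) (Fin (3 + 1)) R) (i j : Fin (3 + 1)) :
    (P * Q) i j = P i 0 * Q 0 j + P i 1 * Q 1 j + P i 2 * Q 2 j + P i 3 * Q 3 j :=
  (Matrix.mul_apply ..).trans (Fin.sum_univ_four _)

theorem chain_three_der (z : FreeLaurent F (Fin m) Unit) :
    chain ![φ, ψ, χ, ω] ![f, g, h] z 0 1 = der φ ψ f z ∧
    chain ![φ, ψ, χ, ω] ![f, g, h] z 1 2 = der ψ χ g z ∧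
    chain ![φ, ψ, χ, ω] ![f, g, h] z 2 3 = der χ ω h z :=
  ⟨chain_castSucc_succ _ _ 0 z, chain_castSucc_succ _ _ 1 z, chain_castSucc_succ _ _ 2 z⟩

theorem chain_three_left (z : FreeLaurent F (Fin m) Unit) :
    chain ![φ, ψ, χ, ω] ![f, g, h] z 0 2 = ter φ ψ χ f g z := by
  refine eq_ter (κ := entry (chain ![φ, ψ, χ, ω] ![f, g, h]).toLinearMap 0 2)
    (fun z w => ?_) ?_ (fun l => ?_) z
  · obtain ⟨h1, -, -⟩ := chain_three_der φ ψ χ ω f g h z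
    obtain ⟨-, h2, -⟩ := chain_three_der φ ψ χ ω f g h w
    rw [← h1, ← h2]
    simp only [entry_apply, AlgHom.toLinearMap_apply, map_mul, mul_apply_four, chain_self]
    rw [chain_lower _ _ w (i := 3) (j := 2) (by decide)]
    simp
    abel
  · simp
  · simp only [entry_apply, AlgHom.toLinearMap_apply, chain_gen]
    exact chainGen_of_ne _ _ _ _ _ (by decide) (by simp)

theorem chain_three_right (z : FreeLaurent F (Fin m) Unit) :
    chain ![φ, ψ, χ, ω] ![f, g, h] z 1 3 = ter ψ χ ω g h z := by
  refine eq_ter (κ := entry (chain ![φ, ψ, χ, ω] ![f, g, h]).toLinearMap 1 3)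
    (fun z w => ?_) ?_ (fun l => ?_) z
  · obtain ⟨-, h1, -⟩ := chain_three_der φ ψ χ ω f g h z
    obtain ⟨-, -, h2⟩ := chain_three_der φ ψ χ ω f g h w
    rw [← h1, ← h2]
    simp only [entry_apply, AlgHom.toLinearMap_apply, map_mul, mul_apply_four, chain_self]
    rw [chain_lower _ _ z (i := 1) (j := 0) (by decide)]
    simp
    abel
  · simp
  · simp only [entry_apply, AlgHom.toLinearMap_apply, chain_gen]
    exact chainGen_of_ne _ _ _ _ _ (by decide) (by simp)

/-- A product reaches the corner through either of two middle indices, which gives two mixed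
correction terms. -/
theorem quat_mul (z w : FreeLaurent F (Fin m) Unit) :
    quat φ ψ χ ω f g h (z * w) = quat φ ψ χ ω f g h z * ω w + ter φ ψ χ f g z * der χ ω h w
      + der φ ψ f z * ter ψ χ ω g h w + φ z * quat φ ψ χ ω f g h w := by
  obtain ⟨h1, -, -⟩ := chain_three_der φ ψ χ ω f g h z
  obtain ⟨-, -, h2⟩ := chain_three_der φ ψ χ ω f g h w
  rw [← h1, ← h2, ← chain_three_left φ ψ χ ω f g h, ← chain_three_right φ ψ χ ω f g h]
  simp only [quat, entry_apply, AlgHom.toLinearMap_apply, map_mul, mul_apply_four, chain_self]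
  simp
  abel

theorem quat_eq_zero_of_degree (hφ : ∀ l, D.deg l ≠ 0 → φ (gen l) = 0)
    (hψ : ∀ l, D.deg l ≠ 0 → ψ (gen l) = 0) (hχ : ∀ l, D.deg l ≠ 0 → χ (gen l) = 0)
    (hω : ∀ l, D.deg l ≠ 0 → ω (gen l) = 0)
    (hf : ∀ l, D.deg l ≠ -1 → f l = 0) (hg : ∀ l, D.deg l ≠ -1 → g l = 0)
    (hh : ∀ l, D.deg l ≠ -1 → h l = 0) {q : ℤ} {z : FreeLaurent F (Fin m) Unit}
    (hz : z ∈ homogeneous D.deg q) (hq : q ≠ -3) : quat φ ψ χ ω f g h z = 0 := by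
  refine chain_eq_zero_of_degree ![φ, ψ, χ, ω] ![f, g, h] D ![-3, -2, -1, 0] ?_ ?_ hz 0 3
    (by simpa using hq)
  · intro i l hl
    match i with
    | 0 => exact hφ l hl
    | 1 => exact hψ l hl
    | 2 => exact hχ l hl
    | 3 => exact hω l hl
  · intro s l hl
    match s with
    | 0 => exact hf l (by simpa using hl)
    | 1 => exact hg l (by simpa using hl)
    | 2 => exact hh l (by simpa using hl)

end Quat

variable {ρ₁ ρ₂ ρ₃ ρ₄ : Representation D n} {α β β' : HomSpace F m n}

@[simp]
theorem unitHom_y : unitHom F m n .y = -1 := by simp [unitHom]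

/-- A strict right inverse and a strict left inverse are cohomologous. -/
theorem sub_mem_coboundaries (hα : α ∈ cocycles ρ₁ ρ₂) (hβ : β ∈ cocycles ρ₂ ρ₁)
    (hβ' : β' ∈ cocycles ρ₂ ρ₁) (h : m2 ρ₁ ρ₂ ρ₁ β α = unitHom F m n)
    (h' : m2 ρ₂ ρ₁ ρ₂ α β' = unitHom F m n) : β' - β ∈ coboundaries ρ₂ ρ₁ := by
  have hy : α .y * β .y = 1 := by
    have := congrFun h .y
    rwa [m2_apply_y hα.1 hβ.1, unitHom_y, neg_inj] at this
  have hy' : β' .y * α .y = 1 := by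
    have := congrFun h' .y
    rwa [m2_apply_y hβ'.1 hα.1, unitHom_y, neg_inj] at this
  have hz : chords (unitHom F m n) = 0 := rfl
  -- The unit has no chord components, so a strict inverse makes the homotopy defect vanish
  -- identically.
  have hT (z) : hter ρ₁ ρ₂ ρ₁ α β (D.d z) = hder ρ₁ ρ₂ α (D.parity z) * β .y
      - α .y * hder ρ₂ ρ₁ β z := by
    have := homotopyDefect_eq hα hβ z
    rw [h, hder, hz, der_zero, neg_zero, homotopyDefect_apply] at this
    rw [← sub_eq_zero, ← this]
    abel
  have hT' (z) : hter ρ₂ ρ₁ ρ₂ β' α (D.d z) = hder ρ₂ ρ₁ β' (D.parity z) * α .y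
      - β' .y * hder ρ₁ ρ₂ α z := by
    have := homotopyDefect_eq hβ' hα z
    rw [h', hder, hz, der_zero, neg_zero, homotopyDefect_apply] at this
    rw [← sub_eq_zero, ← this]
    abel
  have hpar (z) : hter ρ₂ ρ₁ ρ₂ β' α (D.parity z) = hter ρ₂ ρ₁ ρ₂ β' α z :=
    ter_parity ρ₂.map_parity ρ₁.map_parity ρ₂.map_parity (chords_eq_zero' hβ'.1)
      (chords_eq_zero' hα.1) z
  let Q := quat ρ₂.toAlgHom ρ₁.toAlgHom ρ₂.toAlgHom ρ₁.toAlgHom (chords β') (chords α) (chords β)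
  -- This is the homotopy behind $(\beta\alpha)\beta'\simeq\beta(\alpha\beta')$. On chords it is
  -- $Q(\partial a_l)$, the expression of $m_3$ type; the other terms vanish there and make $U$ a
  -- derivation.
  let U : FreeLaurent F (Fin m) Unit →ₗ[F] Matrix (Fin n) (Fin n) F :=
    Q ∘ₗ D.d + LinearMap.mulLeft F (β' .y) ∘ₗ hter ρ₁ ρ₂ ρ₁ α β
      - LinearMap.mulRight F (β .y) ∘ₗ hter ρ₂ ρ₁ ρ₂ β' α
  have hU (z) : U z = Q (D.d z) + β' .y * hter ρ₁ ρ₂ ρ₁ α β z - hter ρ₂ ρ₁ ρ₂ β' α z * β .y := rfl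
  have hQ (z w) : Q (z * w) = Q z * ρ₁.toAlgHom w + hter ρ₂ ρ₁ ρ₂ β' α z * hder ρ₂ ρ₁ β w
      + hder ρ₂ ρ₁ β' z * hter ρ₁ ρ₂ ρ₁ α β w + ρ₂.toAlgHom z * Q w := quat_mul ..
  have key : IsDer ρ₂.toAlgHom ρ₁.toAlgHom U := by
    intro z w
    simp only [hU, D.d_mul_parity, map_add, hter_mul, hQ, ρ₁.map_d, ρ₂.map_d,
      ρ₂.map_parity, hT, hT', hpar, cocycle_homotopy hβ', cocycle_homotopy hβ, hder_parity hβ'.1,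
      hder_parity hα.1]
    noncomm_ring
  -- By $\partial^2=0$ only the two `hter` terms remain. Their mixed terms in $\alpha$ cancel, while
  -- $\alpha_y\beta_y=1$ and $\beta'_y\alpha_y=1$ leave the difference of the inverses.
  have hUd (z) : U (D.d z) = hder ρ₂ ρ₁ β' z - hder ρ₂ ρ₁ β z := by
    have e1 : β' .y * (hder ρ₁ ρ₂ α (D.parity z) * β .y - α .y * hder ρ₂ ρ₁ β z) =
        β' .y * hder ρ₁ ρ₂ α (D.parity z) * β .y - β' .y * α .y * hder ρ₂ ρ₁ β z := by
      noncomm_ring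
    have e2 : (hder ρ₂ ρ₁ β' (D.parity z) * α .y - β' .y * hder ρ₁ ρ₂ α z) * β .y =
        hder ρ₂ ρ₁ β' (D.parity z) * (α .y * β .y) - β' .y * hder ρ₁ ρ₂ α z * β .y := by
      noncomm_ring
    rw [hU, D.d_d, map_zero, hT, hT', e1, e2, hy, hy', hder_parity hα.1, hder_parity hβ'.1]
    noncomm_ring
  have hUder (z) := key.eq_der (by
    simp only [hU, D.d_tGen, map_zero, ter_tGen, mul_zero, zero_mul, add_zero, sub_zero]) z
  have hε : ofChords (fun l => U (gen l)) ∈ homDeg D n (-1) :=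
    ofChords_mem (p := -2) fun l hl => by
      have hQ0 : Q (D.d (gen l)) = 0 := quat_eq_zero_of_degree _ _ _ _ _ _ _ ρ₂.map_gen ρ₁.map_gen
        ρ₂.map_gen ρ₁.map_gen (chords_eq_zero' hβ'.1) (chords_eq_zero' hα.1)
        (chords_eq_zero' hβ.1) (D.d_gen_mem l) (by omega)
      rw [hU, hQ0, ter_gen, ter_gen]
      simp
  refine ⟨ofChords fun l => U (gen l), hε, ?_⟩
  funext c
  cases c with
  | a l =>
    rw [m1_chord_of_degree hε]
    change der ρ₂.toAlgHom ρ₁.toAlgHom (fun l => U (gen l)) _ = _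
    rw [← hUder, hUd, der_gen, der_gen]
    rfl
  | x =>
    rw [Pi.sub_apply, m1_x_of_degree hε, x_eq_zero hβ.1 (by simp), x_eq_zero hβ'.1 (by simp),
      sub_zero]
  | y =>
    rw [Pi.sub_apply, m1_apply_y, ← left_inv_eq_right_inv hy' hy, sub_self]

/-! ### The target of a degree zero morphism -/

theorem exists_height_recursion {X : Type*} [Zero X] (G : Fin m → (Fin m → X) → X)
    (hG : ∀ l v v', (∀ j < l, v j = v' j) → G l v = G l v') : ∃ v, ∀ l, v l = G l v := by
  let v : Fin m → X := WellFounded.fix (wellFounded_lt (α := Fin m))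
    fun l ih => G l fun j => if h : j < l then ih j h else 0
  refine ⟨v, fun l => ?_⟩
  have : v l = G l fun j => if h : j < l then v j else 0 :=
    WellFounded.fix_eq (wellFounded_lt (α := Fin m)) _ l
  rw [this]
  exact hG _ _ _ fun j hj => by simp [hj]

theorem der_eqOn_below {R : Type*} [Ring R] [Algebra F R]
    (φ : FreeLaurent F (Fin m) Unit →ₐ[F] R) {ψ ψ' : FreeLaurent F (Fin m) Unit →ₐ[F] R}
    (f : Fin m → R) {l : Fin m} (ht : ψ (tGen F m).val = ψ' (tGen F m).val)
    (hg : ∀ j < l, ψ (gen j) = ψ' (gen j)) {z : FreeLaurent F (Fin m) Unit} (hz : z ∈ below F l) :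
    der φ ψ f z = der φ ψ' f z := by
  refine congrFun (congrFun (chain_eqOn_below _ _ _ _ (fun r => ?_) (fun r j hj => ?_)
    (fun _ _ _ => rfl) hz) _) _
  · match r with
    | 0 => rfl
    | 1 => exact ht
  · match r with
    | 0 => rfl
    | 1 => exact hg j hj

/-- The cocycle equation at $a_l$ gives $\alpha_y\rho_2(a_l)$ in terms of $\rho_1$, $\alpha$ and
$\rho_2$ below $a_l$; cancelling $\alpha_y$ gives uniqueness by induction on height. -/
theorem target_unique {ρ₂' : Representation D n} (hy : IsUnit (α .y)) (h : α ∈ cocycles ρ₁ ρ₂)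
    (h' : α ∈ cocycles ρ₁ ρ₂') : ρ₂ = ρ₂' := by
  obtain ⟨-, h1, h2⟩ := mem_cocycles_iff.1 h
  obtain ⟨-, h1', h2'⟩ := mem_cocycles_iff.1 h'
  have ht : ρ₂.toAlgHom (tGen F m).val = ρ₂'.toAlgHom (tGen F m).val :=
    hy.mul_left_cancel (h2.trans h2'.symm)
  refine Representation.ext_toAlgHom (algHom_ext (fun l => ?_) ht)
  induction l using WellFoundedLT.induction with
  | ind l ih =>
    have e : hder ρ₁ ρ₂ α (D.d (gen l)) = hder ρ₁ ρ₂' α (D.d (gen l)) :=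
      der_eqOn_below _ _ ht ih (D.d_height l)
    have := (h1 l).trans (h1' l).symm
    rw [e, sub_left_inj] at this
    exact hy.mul_left_cancel (add_left_cancel this)

/-- An algebra map that satisfies the homotopy relation on generators with an invertible `y`
component is a representation. -/
theorem map_d_of_homotopy (ρ : Representation D n)
    {ψ : FreeLaurent F (Fin m) Unit →ₐ[F] Matrix (Fin n) (Fin n) F}
    {g : (Matrix (Fin n) (Fin n) F)ˣ} (hψ0 : ∀ l, D.deg l ≠ 0 → ψ (gen l) = 0)
    (ht : g.val * ψ (tGen F m).val = ρ.toAlgHom (tGen F m).val * g.val)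
    (hgen : ∀ l, der ρ.toAlgHom ψ (chords α) (D.d (gen l)) + g.val * ψ (gen l)
      - ρ.toAlgHom (gen l) * g.val = 0) (z : FreeLaurent F (Fin m) Unit) : ψ (D.d z) = 0 := by
  have ht' : g.val * ψ ((tGen F m)⁻¹).val = ρ.toAlgHom ((tGen F m)⁻¹).val * g.val := by
    refine sub_eq_zero.1 ((map_eq_zero_iff ρ.toAlgHom () _).1 ?_)
    rw [mul_sub, ← mul_assoc, ← mul_assoc, ← map_mul, ← ht, mul_assoc, ← map_mul, Units.mul_inv,
      map_one, map_one, mul_one, one_mul, sub_self]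
  have hpar : ∀ z, ψ (D.parity z) = ψ z := by
    have : ψ.comp D.parity = ψ := by
      refine algHom_ext (fun l => ?_) (by simp)
      rw [AlgHom.comp_apply, D.parity_gen, map_smul]
      by_cases h : D.deg l = 0
      · simp [h]
      · simp [hψ0 l h]
    exact DFunLike.congr_fun this
  have hder' := der_isDer ρ.toAlgHom ψ (chords α)
  -- The two conditions must be carried together: the homotopy relation is closed under products
  -- only when $\psi\partial$ vanishes on the second factor.
  let P : Subalgebra F (FreeLaurent F (Fin m) Unit) :=
    { carrier := {z | ψ (D.d z) = 0 ∧ der ρ.toAlgHom ψ (chords α) (D.d z) + g.val * ψ z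
        - ρ.toAlgHom z * g.val = 0}
      mul_mem' := by
        rintro z w ⟨h1, h2⟩ ⟨h1', h2'⟩
        refine ⟨?_, ?_⟩
        · simp [D.d_mul_parity, h1, h1']
        · rw [D.d_mul_parity, map_add, hder', hder', h1', ρ.map_d, ρ.map_parity, map_mul, map_mul]
          have e : der ρ.toAlgHom ψ (chords α) (D.d z) * ψ w
              + 0 * der ρ.toAlgHom ψ (chords α) w + (der ρ.toAlgHom ψ (chords α) (D.parity z) * 0 +
                ρ.toAlgHom z * der ρ.toAlgHom ψ (chords α) (D.d w)) + g.val * (ψ z * ψ w)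
              - ρ.toAlgHom z * ρ.toAlgHom w * g.val =
              (der ρ.toAlgHom ψ (chords α) (D.d z) + g.val * ψ z - ρ.toAlgHom z * g.val) * ψ w
              + ρ.toAlgHom z * (der ρ.toAlgHom ψ (chords α) (D.d w) + g.val * ψ w
                - ρ.toAlgHom w * g.val) := by noncomm_ring
          rw [e, h2, h2', zero_mul, mul_zero, add_zero]
      add_mem' := by
        rintro z w ⟨h1, h2⟩ ⟨h1', h2'⟩
        refine ⟨by simp [h1, h1'], ?_⟩
        rw [map_add, map_add, map_add, map_add, ← add_zero 0]
        nth_rewrite 1 [← h2]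
        rw [← h2']
        noncomm_ring
      algebraMap_mem' := by
        intro r
        have hd1 : D.d 1 = 0 := by simpa using D.d_inv 0
        have hd : D.d (algebraMap F _ r) = 0 := by
          rw [Algebra.algebraMap_eq_smul_one, map_smul, hd1, smul_zero]
        refine ⟨by rw [hd, map_zero], ?_⟩
        rw [hd, map_zero, AlgHom.commutes, AlgHom.commutes, Algebra.commutes]
        simp }
  have hPt : (tGen F m).val ∈ P := ⟨by rw [D.d_tGen, map_zero], by
    rw [D.d_tGen, map_zero, ht]; simp⟩
  have hdt' : D.d ((tGen F m)⁻¹).val = 0 := by simpa using D.d_inv (-1)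
  have hPt' : ((tGen F m)⁻¹).val ∈ P := ⟨by rw [hdt', map_zero], by
    rw [hdt', map_zero, ht']; simp⟩
  have hPg : ∀ l, gen l ∈ P := by
    intro l
    induction l using WellFoundedLT.induction with
    | ind l ih =>
      refine ⟨?_, hgen l⟩
      -- By induction the homotopy relation holds for $\partial a_l$ itself. There $\partial^2=0$
      -- and $\rho\partial=0$ leave only $g\,\psi(\partial a_l)=0$.
      have h2 := (below_le hPt hPt' ih (D.d_height l)).2
      rw [D.d_d, map_zero, ρ.map_d, zero_mul, zero_add, sub_zero] at h2
      exact g.isUnit.mul_right_eq_zero.1 h2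
  exact (mem_of_generators P hPg (fun _ => hPt) (fun _ => hPt') z).1

/-- The algebra map determined by a degree zero morphism with invertible `y` component. -/
theorem exists_target_algHom
    (φ : FreeLaurent F (Fin m) Unit →ₐ[F] Matrix (Fin n) (Fin n) F)
    (hφ : ∀ l, D.deg l ≠ 0 → φ (gen l) = 0) (hα : α ∈ homDeg D n 0)
    (g : (Matrix (Fin n) (Fin n) F)ˣ) :
    ∃ ψ : FreeLaurent F (Fin m) Unit →ₐ[F] Matrix (Fin n) (Fin n) F,
      (∀ l, D.deg l ≠ 0 → ψ (gen l) = 0) ∧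
      g.val * ψ (tGen F m).val = φ (tGen F m).val * g.val ∧
      ∀ l, der φ ψ (chords α) (D.d (gen l)) + g.val * ψ (gen l) - φ (gen l) * g.val = 0 := by
  let u : Unit → (Matrix (Fin n) (Fin n) F)ˣ :=
    fun _ => g⁻¹ * Units.map φ.toMonoidHom (tGen F m) * g
  -- The equation at $a_l$ is solved for $\psi(a_l)$. It is imposed only in degree $0$; elsewhere
  -- the value must be zero for a representation.
  obtain ⟨v, hv⟩ := exists_height_recursion (X := Matrix (Fin n) (Fin n) F) (fun l v =>
    if D.deg l = 0 then g⁻¹.val * (φ (gen l) * g.val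
      - der φ (lift (F := F) v u) (chords α) (D.d (gen l))) else 0) (by
    intro l v v' h
    have e : der φ (lift (F := F) v u) (chords α) (D.d (gen l)) =
        der φ (lift (F := F) v' u) (chords α) (D.d (gen l)) :=
      der_eqOn_below _ _ (by rw [lift_inv, lift_inv])
        (fun j hj => by rw [lift_gen, lift_gen, h j hj]) (D.d_height l)
    simp only [e])
  obtain ⟨ψ, hψ⟩ : ∃ ψ, ψ = lift (F := F) v u := ⟨_, rfl⟩
  have hψg (l) : ψ (gen l) = v l := by rw [hψ, lift_gen]
  have hψt : ψ (tGen F m).val = (u ()).val := by rw [hψ, lift_inv]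
  rw [← hψ] at hv
  have hψ0 : ∀ l, D.deg l ≠ 0 → ψ (gen l) = 0 := fun l hl => by
    rw [hψg, hv l, if_neg hl]
  refine ⟨ψ, hψ0, ?_, fun l => ?_⟩
  · rw [hψt]
    simp only [u, Units.val_mul, ← mul_assoc, Units.mul_inv, one_mul, Units.coe_map]
    rfl
  · by_cases hl : D.deg l = 0
    · rw [hψg, hv l, if_pos hl, ← mul_assoc, Units.mul_inv, one_mul]
      abel
    -- For $|a_l|\ne 0$ the equation is automatic: $\partial a_l$ does not have degree $-1$, so the
    -- derivation vanishes on it.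
    · rw [hψ0 l hl, hφ l hl, der_eq_zero_of_degree hφ hψ0 (chords_eq_zero' hα)
        (D.d_gen_mem l) (by omega)]
      simp

theorem exists_target (ρ : Representation D n) (hα : α ∈ homDeg D n 0) (hy : IsUnit (α .y)) :
    ∃ ρ₀ : Representation D n, α ∈ cocycles ρ ρ₀ := by
  obtain ⟨g, hg⟩ := hy
  obtain ⟨ψ, hψ0, ht, hgen⟩ := exists_target_algHom ρ.toAlgHom ρ.map_gen hα g
  refine ⟨⟨ψ, map_d_of_homotopy ρ hψ0 ht hgen, hψ0⟩, mem_cocycles_iff.2 ⟨hα, fun l => ?_, ?_⟩⟩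
  · rw [← hg]; exact hgen l
  · rw [← hg]; exact ht

/-! ### Isomorphisms -/

/-- The cocycles of degree `0` whose coefficient at `y^∨` is invertible. -/
def isoCocycles (ρ₁ ρ₂ : Representation D n) : Set (HomSpace F m n) :=
  {α | α ∈ cocycles ρ₁ ρ₂ ∧ IsUnit (α .y)}

variable {ρ₁ ρ₂ ρ₃ : Representation D n} {α β : HomSpace F m n}

theorem m2_mem_isoCocycles (hα : α ∈ isoCocycles ρ₁ ρ₂) (hβ : β ∈ isoCocycles ρ₂ ρ₃) :
    m2 ρ₁ ρ₂ ρ₃ β α ∈ isoCocycles ρ₁ ρ₃ :=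
  ⟨m2_mem_cocycles hα.1 hβ.1, by rw [m2_apply_y hα.1.1 hβ.1.1]; exact (hα.2.mul hβ.2).neg⟩

theorem unitHom_mem_isoCocycles (ρ : Representation D n) : unitHom F m n ∈ isoCocycles ρ ρ :=
  ⟨unitHom_mem ρ, by rw [unitHom_y]; exact isUnit_one.neg⟩

/-- Coboundaries have no $y^\vee$ component, so inverse classes have exactly inverse coefficients at
$y^\vee$. -/
theorem MutuallyInverse.isUnit {α : cocycles ρ₁ ρ₂} {β : cocycles ρ₂ ρ₁}
    (h : MutuallyInverse ρ₁ ρ₂ α β) : IsUnit (α.1 .y) ∧ IsUnit (β.1 .y) := by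
  have h1 : α.1 .y * β.1 .y = 1 := by
    have := coboundaries_y h.1
    rw [Pi.sub_apply, m2_apply_y α.2.1 β.2.1, unitHom_y, sub_neg_eq_add, neg_add_eq_zero] at this
    exact this
  have h2 : β.1 .y * α.1 .y = 1 := by
    have := coboundaries_y h.2
    rw [Pi.sub_apply, m2_apply_y β.2.1 α.2.1, unitHom_y, sub_neg_eq_add, neg_add_eq_zero] at this
    exact this
  exact ⟨⟨⟨_, _, h1, h2⟩, rfl⟩, ⟨⟨_, _, h2, h1⟩, rfl⟩⟩

/-- The degree zero morphisms with invertible `y` component. -/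
def invertibleMorphisms (D : ChordDGA F m) (n : ℕ) : Set (HomSpace F m n) :=
  {α | α ∈ homDeg D n 0 ∧ IsUnit (α .y)}

/-- A degree zero morphism with invertible `y` component is a cocycle for exactly one target. -/
theorem bijective_target (ρ : Representation D n) : Function.Bijective
    (fun p : Σ ρ₀ : Representation D n, isoCocycles ρ ρ₀ =>
      (⟨p.2.1, p.2.2.1.1, p.2.2.2⟩ : invertibleMorphisms D n)) := by
  refine ⟨?_, ?_⟩
  · rintro ⟨ρ₀, α, hα⟩ ⟨ρ₀', α', hα'⟩ h
    obtain rfl : α = α' := congrArg Subtype.val h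
    obtain rfl := target_unique hα.2 hα.1 hα'.1
    rfl
  · rintro ⟨α, hα, hy⟩
    obtain ⟨ρ₀, h⟩ := exists_target ρ hα hy
    exact ⟨⟨ρ₀, α, h, hy⟩, rfl⟩

theorem m2_injective (ρ₃ : Representation D n) (hβ : β ∈ isoCocycles ρ₁ ρ₂) :
    Function.Injective (fun α : isoCocycles ρ₃ ρ₁ =>
      (⟨m2 ρ₃ ρ₁ ρ₂ β α.1, m2_mem_isoCocycles α.2 hβ⟩ : isoCocycles ρ₃ ρ₂)) := by
  rintro ⟨α, hα⟩ ⟨α', hα'⟩ h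
  exact Subtype.ext (m2_right_injective hβ.1.1 hβ.2 hα.1.1 hα'.1.1 (congrArg Subtype.val h))

/-! ### Inverses by pigeonhole -/

section Finite

variable [Finite F]

instance : Finite (HomSpace F m n) := inferInstance

instance : Finite (Representation D n) := by
  refine Finite.of_injective (β := (Fin m → Matrix (Fin n) (Fin n) F) × Matrix (Fin n) (Fin n) F)
    (fun ρ => (fun l => ρ.toAlgHom (gen l), ρ.toAlgHom (tGen F m).val)) fun ρ ρ' h => ?_
  rw [Prod.mk.injEq] at h
  exact Representation.ext_toAlgHom (algHom_ext (fun l => congrFun h.1 l) h.2)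

/-- Precomposition with $\alpha$ maps all isomorphism cocycles out of $\rho_2$ injectively to those
out of $\rho_1$, preserving targets. Both sets biject with the degree-$0$ morphisms with invertible
$y^\vee$ coefficient, so the map is onto and hits the unit of $\rho_1$. -/
theorem exists_left_inverse (hα : α ∈ isoCocycles ρ₁ ρ₂) :
    ∃ β ∈ isoCocycles ρ₂ ρ₁, m2 ρ₁ ρ₂ ρ₁ β α = unitHom F m n := by
  let f : (Σ ρ₀ : Representation D n, isoCocycles ρ₂ ρ₀) →
      Σ ρ₀ : Representation D n, isoCocycles ρ₁ ρ₀ :=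
    fun p => ⟨p.1, m2 ρ₁ ρ₂ p.1 p.2.1 α, m2_mem_isoCocycles hα p.2.2⟩
  have hinj : Function.Injective f := by
    rintro ⟨ρ₀, β, hβ⟩ ⟨ρ₀', β', hβ'⟩ h
    obtain rfl : ρ₀ = ρ₀' := congrArg Sigma.fst h
    have h2 := congrArg (fun p : Σ ρ₀ : Representation D n, isoCocycles ρ₁ ρ₀ => p.2.1) h
    obtain rfl := m2_left_injective hα.1.1 hα.2 hβ.1.1 hβ'.1.1 h2
    rfl
  have hbij := (Nat.bijective_iff_injective_and_card f).2 ⟨hinj, by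
    rw [Nat.card_eq_of_bijective _ (bijective_target ρ₁),
      Nat.card_eq_of_bijective _ (bijective_target ρ₂)]⟩
  obtain ⟨⟨ρ₀, β, hβ⟩, h⟩ := hbij.2 ⟨ρ₁, unitHom F m n, unitHom_mem_isoCocycles ρ₁⟩
  have h2 := congrArg (fun p : Σ ρ₀ : Representation D n, isoCocycles ρ₁ ρ₀ => p.2.1) h
  obtain rfl : ρ₀ = ρ₁ := congrArg Sigma.fst h
  exact ⟨β, hβ, h2⟩

/-- Composition with $\beta$ and with a left inverse of $\beta$ gives injections in both directions.
-/
theorem card_isoCocycles (ρ₃ : Representation D n) (hβ : β ∈ isoCocycles ρ₁ ρ₂) :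
    Nat.card (isoCocycles ρ₃ ρ₁) = Nat.card (isoCocycles ρ₃ ρ₂) := by
  obtain ⟨γ, hγ, -⟩ := exists_left_inverse hβ
  exact le_antisymm (Nat.card_le_card_of_injective _ (m2_injective ρ₃ hβ))
    (Nat.card_le_card_of_injective _ (m2_injective ρ₃ hγ))

theorem exists_right_inverse (hα : α ∈ isoCocycles ρ₁ ρ₂) :
    ∃ β ∈ isoCocycles ρ₂ ρ₁, m2 ρ₂ ρ₁ ρ₂ α β = unitHom F m n := by
  have hbij := (Nat.bijective_iff_injective_and_card _).2
    ⟨m2_injective ρ₂ hα, card_isoCocycles ρ₂ hα⟩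
  obtain ⟨β, h⟩ := hbij.2 ⟨unitHom F m n, unitHom_mem_isoCocycles ρ₂⟩
  exact ⟨β.1, β.2, congrArg Subtype.val h⟩

/-- The strict left inverse also works on the other side: it is cohomologous to a strict right
inverse, and composition with $\alpha$ respects this relation. -/
theorem exists_mutuallyInverse (hα : α ∈ isoCocycles ρ₁ ρ₂) :
    ∃ β : cocycles ρ₂ ρ₁, MutuallyInverse ρ₁ ρ₂ ⟨α, hα.1⟩ β := by
  obtain ⟨β, hβ, h⟩ := exists_left_inverse hα
  obtain ⟨β', hβ', h'⟩ := exists_right_inverse hα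
  refine ⟨⟨β, hβ.1⟩, ?_, ?_⟩
  · rw [h, sub_self]
    exact Submodule.zero_mem _
  · rw [← h']
    exact m2_sub_m2_mem hα.1 hβ.1 hβ'.1 (sub_mem_coboundaries hα.1 hβ.1 hβ'.1 h h')

theorem isomorphic_iff : Isomorphic ρ₁ ρ₂ ↔ (isoCocycles ρ₁ ρ₂).Nonempty := by
  constructor
  · rintro ⟨α, β, h⟩
    exact ⟨α.1, α.2, h.isUnit.1⟩
  · rintro ⟨α, hα⟩
    obtain ⟨β, h⟩ := exists_mutuallyInverse hα
    exact ⟨_, β, h⟩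

theorem mem_Aut_iff {ρ : Representation D n} (α : cocycles ρ ρ) :
    (Submodule.Quotient.mk α : H0 ρ ρ) ∈ Aut ρ ↔ IsUnit (α.1 .y) := by
  constructor
  · rintro ⟨α', β, h, h'⟩
    rw [Submodule.Quotient.eq] at h
    have h1 : (α' - α : HomSpace F m n) ∈ coboundaries ρ ρ := h
    have h2 := coboundaries_y h1
    rw [Pi.sub_apply, sub_eq_zero] at h2
    rw [← h2]
    exact h'.isUnit.1
  · intro h
    obtain ⟨β, hβ⟩ := exists_mutuallyInverse (α := α.1) ⟨α.2, h⟩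
    exact ⟨α, β, rfl, hβ⟩

/-! ### Counting -/

/-- Sorting the morphisms by their unique target gives one nonempty piece per isomorphic $\rho_0$,
all of the size of the piece at $\rho$. -/
theorem card_invertibleMorphisms (ρ : Representation D n) :
    Nat.card (invertibleMorphisms D n) =
      Nat.card {ρ₀ : Representation D n // Isomorphic ρ ρ₀} * Nat.card (isoCocycles ρ ρ) := by
  have e : (Σ ρ₀ : {ρ₀ : Representation D n // Isomorphic ρ ρ₀}, isoCocycles ρ ρ₀.1) ≃
      Σ ρ₀ : Representation D n, isoCocycles ρ ρ₀ :=
    { toFun := fun p => ⟨p.1.1, p.2⟩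
      invFun := fun p => ⟨⟨p.1, isomorphic_iff.2 ⟨_, p.2.2⟩⟩, p.2⟩
      left_inv := fun _ => rfl
      right_inv := fun _ => rfl }
  have := Fintype.ofFinite {ρ₀ : Representation D n // Isomorphic ρ ρ₀}
  rw [← Nat.card_eq_of_bijective _ (bijective_target ρ), ← Nat.card_congr e, Nat.card_sigma,
    Finset.sum_congr rfl (g := fun _ => Nat.card (isoCocycles ρ ρ))]
  · simp
  · rintro ⟨ρ₀, h⟩ -
    obtain ⟨α, hα⟩ := isomorphic_iff.1 h
    exact (card_isoCocycles ρ hα).symm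

theorem card_isoCocycles_self (ρ : Representation D n) :
    Nat.card (isoCocycles ρ ρ) = Nat.card (Aut ρ) * Nat.card (coboundaries ρ ρ) := by
  let f : isoCocycles ρ ρ → Aut ρ := fun α =>
    ⟨Submodule.Quotient.mk ⟨α.1, α.2.1⟩, (mem_Aut_iff _).2 α.2.2⟩
  have hf (α β : isoCocycles ρ ρ) : f α = f β ↔ α.1 - β.1 ∈ coboundaries ρ ρ := by
    simp only [f, Subtype.mk.injEq, Submodule.Quotient.eq]
    rfl
  have hsurj : Function.Surjective f := by
    rintro ⟨u, α, β, rfl, h⟩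
    exact ⟨⟨α.1, α.2, h.isUnit.1⟩, rfl⟩
  -- A fibre is a coset of the coboundaries; adding a coboundary leaves the $y^\vee$ coefficient
  -- unchanged, hence invertible.
  have hfib (u : Aut ρ) : Nat.card {α // f α = u} = Nat.card (coboundaries ρ ρ) := by
    obtain ⟨β, rfl⟩ := hsurj u
    refine Nat.card_congr
      { toFun := fun α => ⟨α.1.1 - β.1, (hf _ _).1 α.2⟩
        invFun := fun γ => ⟨⟨γ.1 + β.1, Submodule.add_mem _ (coboundaries_le γ.2) β.2.1, by
          rw [Pi.add_apply, coboundaries_y γ.2, zero_add]; exact β.2.2⟩, (hf _ _).2 (by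
          rw [add_sub_cancel_right]; exact γ.2)⟩
        left_inv := fun α => by ext1; ext1; exact sub_add_cancel _ _
        right_inv := fun γ => by ext1; exact add_sub_cancel_right _ _ }
  have := Finite.of_surjective f hsurj
  have := Fintype.ofFinite (Aut ρ)
  rw [← Nat.card_congr (Equiv.sigmaFiberEquiv f), Nat.card_sigma,
    Finset.sum_congr rfl fun u _ => hfib u]
  simp

end Finite

/-- Degree zero morphisms are determined by the `y` component and the other components. -/
def splitY (D : ChordDGA F m) (n : ℕ) (S : Set (Matrix (Fin n) (Fin n) F)) :
    {α : HomSpace F m n // α ∈ homDeg D n 0 ∧ α .y ∈ S} ≃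
      S × {α : HomSpace F m n // α ∈ homDeg D n 0 ∧ α .y = 0} where
  toFun α := (⟨α.1 .y, α.2.2⟩, ⟨Function.update α.1 .y 0, fun c hc => by
    by_cases h : c = .y
    · subst h; simp
    · rw [Function.update_of_ne h]; exact α.2.1 c hc, by simp⟩)
  invFun p := ⟨Function.update p.2.1 .y p.1.1, fun c hc => by
    by_cases h : c = .y
    · subst h; exact absurd rfl hc
    · rw [Function.update_of_ne h]; exact p.2.2.1 c hc, by simp⟩
  left_inv α := by simp
  right_inv p := by
    ext1
    · simp
    · ext1
      simp [← p.2.2.2]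

/-- The $y^\vee$ coefficient is a free $n\times n$ matrix, independent of the rest. Comparing
invertible coefficients with arbitrary ones eliminates the number of choices for the remaining
components. -/
theorem card_invertibleMorphisms_mul (D : ChordDGA F m) (n : ℕ) :
    Nat.card (invertibleMorphisms D n) * Nat.card F ^ n ^ 2 =
      Nat.card (Matrix.GeneralLinearGroup (Fin n) F) *
        Nat.card F ^ Module.finrank F (homDeg D n 0) := by
  have h1 := Nat.card_congr (splitY D n {M | IsUnit M})
  have h2 := Nat.card_congr (splitY D n Set.univ)
  have h3 : Nat.card {α : HomSpace F m n // α ∈ homDeg D n 0 ∧ α .y ∈ Set.univ} =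
      Nat.card (homDeg D n 0) := Nat.card_congr (Equiv.subtypeEquivRight fun α => by simp)
  have h4 : Nat.card (Matrix.GeneralLinearGroup (Fin n) F) =
      Nat.card ({M | IsUnit M} : Set (Matrix (Fin n) (Fin n) F)) :=
    Nat.card_eq_of_bijective (fun u => ⟨u.val, u.isUnit⟩)
      ⟨fun u v h => Units.ext (congrArg Subtype.val h), fun ⟨M, u, hu⟩ => ⟨u, Subtype.ext hu⟩⟩
  have h5 : Nat.card (Set.univ : Set (Matrix (Fin n) (Fin n) F)) = Nat.card F ^ n ^ 2 := by
    rw [Nat.card_congr (Equiv.Set.univ _), Module.natCard_eq_pow_finrank (K := F),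
      Module.finrank_matrix]
    simp [sq]
  rw [Nat.card_prod] at h1 h2
  rw [h3, h5] at h2
  rw [← Module.natCard_eq_pow_finrank, h2, h4]
  change Nat.card {α : HomSpace F m n // α ∈ homDeg D n 0 ∧ α .y ∈ {M | IsUnit M}} * _ = _
  rw [h1]
  ring

end RepCat
end

/-! ### Assembling the count -/

theorem mainTheorem4 {F : Type*} [Field F] [Finite F] {m : ℕ} (D : RepCat.ChordDGA F m) (n : ℕ)
    (ρ : RepCat.Representation D n) :
    (Nat.card {ρ₀ : RepCat.Representation D n // RepCat.Isomorphic ρ ρ₀} : ℚ) =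
      (Nat.card (Matrix.GeneralLinearGroup (Fin n) F) : ℚ) / (Nat.card (RepCat.Aut ρ) : ℚ) *
        (Nat.card F : ℚ) ^ ((Module.finrank F (RepCat.homDeg D n 0) : ℤ)
          - (Module.finrank F (RepCat.coboundaries ρ ρ) : ℤ) - (n : ℤ) ^ 2) := by
  have h1 := RepCat.card_invertibleMorphisms ρ
  have h2 := RepCat.card_isoCocycles_self ρ
  have h3 := RepCat.card_invertibleMorphisms_mul D n
  have h4 : Nat.card (RepCat.isoCocycles ρ ρ) ≠ 0 :=
    Nat.card_ne_zero.2 ⟨⟨_, RepCat.unitHom_mem_isoCocycles ρ⟩, inferInstance⟩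
  rw [Module.natCard_eq_pow_finrank (K := F) (V := RepCat.coboundaries ρ ρ)] at h2
  -- The unit lies among the isomorphism cocycles, so their number, which has $|\mathrm{Aut}(\rho)|$
  -- as a factor, is nonzero.
  have hA : (Nat.card (RepCat.Aut ρ) : ℚ) ≠ 0 := by
    intro h
    rw [Nat.cast_eq_zero] at h
    rw [h, zero_mul] at h2
    exact h4 h2
  have hq : (Nat.card F : ℚ) ≠ 0 := Nat.cast_ne_zero.2 Nat.card_pos.ne'
  rw [h1, h2] at h3
  have h5 := congrArg (Nat.cast (R := ℚ)) h3
  push_cast at h5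
  have e : ((n : ℤ) ^ 2) = ((n ^ 2 : ℕ) : ℤ) := by push_cast; rfl
  rw [e, zpow_sub₀ hq, zpow_sub₀ hq, zpow_natCast, zpow_natCast, zpow_natCast]
  field_simp
  linear_combination h5
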